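/- Consider the classical Cramér–Lundberg risk model with premium rate $1$, in which claims arrive according to a Poisson process with rate $\lambda>0$ and claim sizes are i.i.d., independent of the arrivals, with law $(1-\epsilon)\,\mathrm{law}(B)+\epsilon\,\mathrm{law}(C)$, where $\epsilon\in[0,1]$. Here $B$ has a phase-type distribution, $C\ge 0$, and $0<\mathbb E B<\infty$, $0<\mathbb E C<\infty$. Put $\delta=\lambda\,\mathbb E B$, $\theta=\lambda\,\mathbb E C$ and assume $(1-\epsilon)\delta+\epsilon\theta<1$. Let $\psi_\epsilon(u)=\mathbb P(M_\epsilon>u)$ be the probability of ultimate ruin with initial capital $u$, where $M_\epsilon=\sup_{t\ge0}S_\epsilon(t)$ and $S_\epsilon(t)$ is the total of the claims up to time $t$ minus $t$. Let $M^\bullet_{\epsilon,0},M^\bullet_{\epsilon,1}$ be independent copies of the supremum of the claim surplus process of the base model in which the claims distributed as $C$ are discarded (i.e. replaced by claims of size $0$), and let $C^e$, independent of them, have the stationary excess distribution of $C$, $\mathbb P(C^e\le u)=\frac1{\mathbb E C}\int_0^u\mathbb P(C>t)\,dt$. The corrected discard approximation is $$\hat\psi_{d,\epsilon}(u)=\mathbb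 P(M^\bullet_{\epsilon,0}>u)+\frac{\epsilon\theta}{1-\delta+\epsilon\delta}\Big(\mathbb P(M^\bullet_{\epsilon,0}+M^\bullet_{\epsilon,1}+C^e>u)-\mathbb P(M^\bullet_{\epsilon,0}>u)\Big).$$ If the distribution $F$ of $C^e$ is subexponential, i.e. $\lim_{u\to\infty}\frac{1-F^{*n}(u)}{1-F(u)}=n$ for every $n\ge1$, then $$1-\frac{\hat\psi_{d,\epsilon}(u)}{\psi_\epsilon(u)}\longrightarrow\frac{\epsilon\theta}{1-\delta+\epsilon\delta}\qquad(u\to\infty).$$ -/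

import Mathlib

open MeasureTheory ProbabilityTheory Filter Topology

noncomputable section

namespace RiskModel

/-- The mean `∫ x dμ(x)` of a law on the real line. -/
def mean (μ : Measure ℝ) : ℝ := ∫ x, x ∂μ

/-- The tail `μ((u, ∞)) = 1 - F(u)`, where `F` is the distribution function of `μ`. -/
def tail (μ : Measure ℝ) (u : ℝ) : ℝ := μ.real (Set.Ioi u)

/-- The `n`-fold convolution of `μ` with itself (the unit mass at `0` for `n = 0`). -/
def convPow (μ : Measure ℝ) : ℕ → Measure ℝ
  | 0 => Measure.dirac 0
  | n + 1 => (convPow μ n).conv μ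

/-- The class of subexponential distributions: laws on `[0, ∞)` such that, for every `n ≥ 1`, the
tail of the `n`-fold convolution is asymptotically `n` times the tail of the law. -/
structure IsSubexponential (μ : Measure ℝ) : Prop where
  isProbabilityMeasure : IsProbabilityMeasure μ
  nonneg : μ (Set.Iio 0) = 0
  tendsto : ∀ n : ℕ, 1 ≤ n →
    Tendsto (fun u : ℝ => tail (convPow μ n) u / tail μ u) atTop (𝓝 (n : ℝ))

/-- The stationary excess law of `μ`: density `μ((t, ∞)) / mean μ` on `[0, ∞)`. -/
def stationaryExcess (μ : Measure ℝ) : Measure ℝ :=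
  (volume.restrict (Set.Ici 0)).withDensity fun t => ENNReal.ofReal (tail μ t / mean μ)

/-- Phase-type laws: the law of the absorption time of a finite-state continuous-time Markov chain
in which absorption is certain. Here `α` is the vector of initial probabilities of the transient
states (the missing mass is the probability of starting in the absorbing state), `T` is the
generator restricted to the transient states, and `exp (x T)` is the matrix of transition
probabilities between the transient states in time `x`, so that the chain is not absorbed by
time `x` with probability `α exp (x T) 1`. -/
structure IsPhaseType (μ : Measure ℝ) : Prop where
  isProbabilityMeasure : IsProbabilityMeasure μ
  nonneg : μ (Set.Iio 0) = 0
  representation : ∃ (m : ℕ) (α : Fin m → ℝ) (T : Matrix (Fin m) (Fin m) ℝ),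
    (∀ i, 0 ≤ α i) ∧ ∑ i, α i ≤ 1 ∧
    (∀ i j, i ≠ j → 0 ≤ T i j) ∧ (∀ i, ∑ j, T i j ≤ 0) ∧ T.det ≠ 0 ∧
    ∀ x : ℝ, 0 ≤ x →
      tail μ x = dotProduct α (Matrix.mulVec (NormedSpace.exp (x • T)) (fun _ => 1))

/-- The mixture `(1 - ε) μ + ε ν`. -/
def mixture (ε : ℝ) (μ ν : Measure ℝ) : Measure ℝ :=
  ENNReal.ofReal (1 - ε) • μ + ENNReal.ofReal ε • ν

/-- An outcome of the risk model: `(ω i).1` is the time between the `i`-th claim and the one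
before it, and `(ω i).2` is the size of the `i`-th claim (`i = 0, 1, …`). -/
abbrev Path : Type := ℕ → ℝ × ℝ

/-- The law of the model with premium rate one: the inter-arrival times are exponential with rate
`lam` (so claims arrive according to a Poisson process with rate `lam`), the claim sizes have
law `G`, and all of these are independent. -/
def pathLaw (lam : ℝ) (G : Measure ℝ) : Measure Path :=
  Measure.infinitePi fun _ : ℕ => (expMeasure lam).prod G

/-- The time at which the claim with index `n` arrives. -/
def arrivalTime (ω : Path) (n : ℕ) : ℝ := ∑ i ∈ Finset.range (n + 1), (ω i).1

/-- The Poisson process `N(t)`: the number of claims that have arrived by time `t`. -/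
def claimCount (ω : Path) (t : ℝ) : ℕ := {n : ℕ | arrivalTime ω n ≤ t}.ncard

/-- The claim surplus process: the claims that have arrived by time `t`, minus the premiums `t`. -/
def surplus (ω : Path) (t : ℝ) : ℝ := (∑ i ∈ Finset.range (claimCount ω t), (ω i).2) - t

/-- The supremum over `t ≥ 0` of the claim surplus process, as an extended real number. -/
def maxSurplus (ω : Path) : EReal := ⨆ t : {t : ℝ // 0 ≤ t}, ((surplus ω t : ℝ) : EReal)

/-- The probability of ultimate ruin with initial capital `u`. -/
def ruinProb (lam : ℝ) (G : Measure ℝ) (u : ℝ) : ℝ :=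
  (pathLaw lam G).real {ω | (u : EReal) < maxSurplus ω}

/-- The exact ruin probability of the mixture model: a claim has law `μB` with probability `1 - ε`
and law `μC` with probability `ε`. -/
def exactRuin (lam ε : ℝ) (μB μC : Measure ℝ) (u : ℝ) : ℝ :=
  ruinProb lam (mixture ε μB μC) u

/-- The claim law of the base model in which the claims with law `μC` are discarded: they are
replaced by claims of size zero. -/
def discardLaw (ε : ℝ) (μB : Measure ℝ) : Measure ℝ := mixture ε μB (Measure.dirac 0)

/-- The discard phase-type approximation: the ruin probability of the base model. -/
def discardRuin (lam ε : ℝ) (μB : Measure ℝ) (u : ℝ) : ℝ :=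
  ruinProb lam (discardLaw ε μB) u

/-- `P(M₀ + M₁ + Cᵉ > u)`, where `M₀` and `M₁` are distributed as the supremum of the claim surplus
process of the base model, `Cᵉ` has the stationary excess law of `μC`, and the three are
independent. -/
def correctionTail (lam ε : ℝ) (μB μC : Measure ℝ) (u : ℝ) : ℝ :=
  ((pathLaw lam (discardLaw ε μB)).prod
      ((pathLaw lam (discardLaw ε μB)).prod (stationaryExcess μC))).real
    {p : Path × Path × ℝ |
      (u : EReal) < maxSurplus p.1 + maxSurplus p.2.1 + ((p.2.2 : ℝ) : EReal)}

/-- The corrected discard approximation, with `δ = lam * mean μB` and `θ = lam * mean μC`. -/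
def correctedDiscard (lam ε : ℝ) (μB μC : Measure ℝ) (u : ℝ) : ℝ :=
  discardRuin lam ε μB u +
    ε * (lam * mean μC) / (1 - lam * mean μB + ε * (lam * mean μB)) *
      (correctionTail lam ε μB μC u - discardRuin lam ε μB u)

/-- The relative error of the corrected discard approximation. -/
def relativeError (lam ε : ℝ) (μB μC : Measure ℝ) (u : ℝ) : ℝ :=
  1 - correctedDiscard lam ε μB μC u / exactRuin lam ε μB μC u

end RiskModel

end

/-!
The proof rests on the renewal equation of the Cramér–Lundberg model and on the calculus of
subexponential tails.

Let `M` be the supremum of the claim surplus process with claim law `G`, where `lam * mean G < 1`.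
Almost surely `M` is the supremum of the random walk embedded at claim arrivals, which is finite by
the strong law of large numbers. Conditioning on the first arrival and the first claim shows that
the distribution function `φ` of `M` is an exponential average of that of `M + X`, `X ∼ G`; taking
right derivatives, integrating back and using Fubini's theorem turns this into the defective
renewal equation `P(M > u) = (K * law M)(u, ∞)`, `u ≥ 0`, where `K` has density
`lam * G((t, ∞))` on `[0, ∞)` (`tail_supLaw_eq`). No series representation of `M` is needed.

Let `F` be the excess law of `C`. If the tails of two finite measures on `[0, ∞)` are
asymptotically `a` and `b` times the tail of `F`, then so is the tail of their convolution, with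
the constant `a |H| + b |G|` (`IsSubexponential.tendsto_tail_conv`): the event that both summands
are large is dominated by the same event for `F * F`, where subexponentiality controls it. The
same estimates inserted into the renewal equation contract towards its fixed point, so that a
kernel of mass `ρ < 1` with tail asymptotic to `k` times that of `F` gives a supremum with constant
`k / (1 - ρ)` (`IsSubexponential.tendsto_tail_of_renewal`).

A phase-type tail decays exponentially (`IsPhaseType.exists_tail_le_exp`), hence faster than the
tail of `F`. The kernel of the base model therefore has constant `0`, and that of the mixture has
constant `ε θ`. Relative to the tail of `F`, the exact ruin probability has the limit
`ε θ / (1 - (1 - ε) δ - ε θ)`, and the corrected discard approximation has the limit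
`ε θ / (1 - δ + ε δ)`; the quotient of the two gives the relative error. For `ε = 0` the
approximation is exact, and only the positivity of the ruin probability is needed
(`tail_supLaw_pos`).
-/

namespace RiskModel

/-! ### Tails of finite measures on the line -/

lemma tail_nonneg (μ : Measure ℝ) (u : ℝ) : 0 ≤ tail μ u := measureReal_nonneg

lemma tail_antitone (μ : Measure ℝ) [IsFiniteMeasure μ] : Antitone (tail μ) :=
  fun _ _ h => measureReal_mono (Set.Ioi_subset_Ioi h)

lemma measurable_tail (μ : Measure ℝ) [IsFiniteMeasure μ] : Measurable (tail μ) :=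
  (tail_antitone μ).measurable

lemma tail_le_univ (μ : Measure ℝ) [IsFiniteMeasure μ] (u : ℝ) : tail μ u ≤ μ.real Set.univ :=
  measureReal_mono (Set.subset_univ _)

lemma real_Iic_add_tail (μ : Measure ℝ) [IsFiniteMeasure μ] (u : ℝ) :
    μ.real (Set.Iic u) + tail μ u = μ.real Set.univ := by
  have := measureReal_add_measureReal_compl (μ := μ) (s := Set.Iic u) measurableSet_Iic
  rwa [Set.compl_Iic] at this

lemma tail_eq_of_neg {μ : Measure ℝ} [IsFiniteMeasure μ] (h0 : μ (Set.Iio 0) = 0) {u : ℝ}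
    (hu : u < 0) : tail μ u = μ.real Set.univ := by
  have h1 := real_Iic_add_tail μ u
  have h2 : μ.real (Set.Iic u) = 0 := by
    rw [measureReal_def, measure_mono_null (Set.Iic_subset_Iio.2 hu) h0]; rfl
  linarith

lemma tendsto_tail_atTop (μ : Measure ℝ) [IsFiniteMeasure μ] :
    Tendsto (tail μ) atTop (𝓝 0) := by
  have h := tendsto_measure_iInter_atTop (μ := μ) (s := fun u : ℝ => Set.Ioi u)
    (fun _ => measurableSet_Ioi.nullMeasurableSet) (fun _ _ h => Set.Ioi_subset_Ioi h)
    ⟨0, measure_ne_top _ _⟩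
  have h2 : (⋂ u : ℝ, Set.Ioi u) = ∅ := by
    ext x; simp only [Set.mem_iInter, Set.mem_Ioi, Set.mem_empty_iff_false, iff_false, not_forall]
    exact ⟨x, lt_irrefl x⟩
  rw [h2, measure_empty] at h
  exact (ENNReal.tendsto_toReal ENNReal.zero_ne_top).comp h

lemma tendsto_real_Iic_atTop (μ : Measure ℝ) [IsFiniteMeasure μ] :
    Tendsto (fun u => μ.real (Set.Iic u)) atTop (𝓝 (μ.real Set.univ)) := by
  have h := (tendsto_tail_atTop μ).const_sub (μ.real Set.univ)
  rw [sub_zero] at h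
  refine h.congr fun u => ?_
  linarith [real_Iic_add_tail μ u]

lemma ae_nonneg_of_Iio {μ : Measure ℝ} (h0 : μ (Set.Iio 0) = 0) : ∀ᵐ x ∂μ, 0 ≤ x := by
  rw [ae_iff]; simpa [Set.Iio] using h0

/-! ### Tails of convolutions -/

lemma tail_conv_eq (G H : Measure ℝ) [IsFiniteMeasure G] [IsFiniteMeasure H] (u : ℝ) :
    tail (G.conv H) u = (G.prod H).real {p | u < p.1 + p.2} := by
  rw [tail, Measure.conv, map_measureReal_apply (by fun_prop) measurableSet_Ioi]
  rfl

lemma conv_Iio_zero {G H : Measure ℝ} [IsFiniteMeasure G] [IsFiniteMeasure H]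
    (hG : G (Set.Iio 0) = 0) (hH : H (Set.Iio 0) = 0) : (G.conv H) (Set.Iio 0) = 0 := by
  rw [Measure.conv, Measure.map_apply (by fun_prop) measurableSet_Iio]
  refine measure_mono_null (t := (Set.Iio 0 ×ˢ Set.univ) ∪ (Set.univ ×ˢ Set.Iio 0)) ?_ ?_
  · intro p hp
    simp only [Set.mem_preimage, Set.mem_Iio] at hp
    by_contra h
    simp only [Set.mem_union, Set.mem_prod, Set.mem_Iio, Set.mem_univ, and_true, true_and,
      not_or, not_lt] at h
    linarith [h.1, h.2]
  · refine measure_union_null ?_ ?_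
    · rw [Measure.prod_prod, hG, zero_mul]
    · rw [Measure.prod_prod, hH, mul_zero]

/-- The part of the tail of a convolution that comes from both summands being larger than `A`. -/
noncomputable def jointTail (G H : Measure ℝ) (A u : ℝ) : ℝ :=
  (G.prod H).real {p | A < p.1 ∧ A < p.2 ∧ u < p.1 + p.2}

lemma measurableSet_jointTail (A u : ℝ) :
    MeasurableSet {p : ℝ × ℝ | A < p.1 ∧ A < p.2 ∧ u < p.1 + p.2} :=
  (measurableSet_lt measurable_const measurable_fst).inter
    ((measurableSet_lt measurable_const measurable_snd).inter
      (measurableSet_lt measurable_const (measurable_fst.add measurable_snd)))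

/-- The three disjoint events counted on the left: one summand is at most `A ≤ u / 2` while the
other alone exceeds `u` (in either order), or both exceed `A`. -/
lemma le_tail_conv {G H : Measure ℝ} [IsFiniteMeasure G] [IsFiniteMeasure H]
    (hG : G (Set.Iio 0) = 0) (hH : H (Set.Iio 0) = 0) {A u : ℝ} (hA : 0 ≤ A) (hu : 2 * A ≤ u) :
    G.real (Set.Iic A) * tail H u + H.real (Set.Iic A) * tail G u + jointTail G H A u
      ≤ tail (G.conv H) u := by
  rw [tail_conv_eq, tail, tail, ← measureReal_prod_prod, mul_comm, ← measureReal_prod_prod,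
    jointTail, ← measureReal_union, ← measureReal_union]
  · refine ENNReal.toReal_mono (measure_ne_top _ _) (measure_mono_ae ?_)
    have h1 : ∀ᵐ p ∂(G.prod H), 0 ≤ p.1 :=
      Measure.quasiMeasurePreserving_fst.ae (ae_nonneg_of_Iio hG)
    have h2 : ∀ᵐ p ∂(G.prod H), 0 ≤ p.2 :=
      Measure.quasiMeasurePreserving_snd.ae (ae_nonneg_of_Iio hH)
    filter_upwards [h1, h2] with p hp1 hp2 hp
    rcases hp with (⟨_, h⟩ | ⟨h, _⟩) | ⟨_, _, h⟩
    · have h' : u < p.2 := h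
      change u < p.1 + p.2; linarith
    · have h' : u < p.1 := h
      change u < p.1 + p.2; linarith
    · exact h
  · rw [Set.disjoint_left]
    rintro p (⟨h, _⟩ | ⟨_, h⟩) ⟨h1, h2, _⟩
    · exact absurd h1 (not_lt.2 h)
    · exact absurd h2 (not_lt.2 h)
  · exact measurableSet_jointTail A u
  · rw [Set.disjoint_left]
    rintro p ⟨h, _⟩ ⟨h1, _⟩
    have ha : p.1 ≤ A := h
    have hb : u < p.1 := h1
    linarith
  · exact measurableSet_Ioi.prod measurableSet_Iic

lemma tail_conv_le {G H : Measure ℝ} [IsFiniteMeasure G] [IsFiniteMeasure H] (A u : ℝ) :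
    tail (G.conv H) u ≤ G.real (Set.Iic A) * tail H (u - A) + H.real (Set.Iic A) * tail G (u - A)
      + jointTail G H A u := by
  rw [tail_conv_eq, tail, tail, ← measureReal_prod_prod, mul_comm (H.real _),
    ← measureReal_prod_prod, jointTail]
  refine le_trans (measureReal_mono ?_) ((measureReal_union_le _ _).trans
    (add_le_add (measureReal_union_le _ _) le_rfl))
  intro p hp
  have hp' : u < p.1 + p.2 := hp
  rcases le_or_gt p.1 A with h1 | h1
  · exact Or.inl (Or.inl ⟨h1, show u - A < p.2 by linarith⟩)
  rcases le_or_gt p.2 A with h2 | h2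
  · exact Or.inl (Or.inr ⟨show u - A < p.1 by linarith, h2⟩)
  · exact Or.inr ⟨h1, h2, hp⟩

lemma jointTail_comm (G H : Measure ℝ) [IsFiniteMeasure G] [IsFiniteMeasure H] (A u : ℝ) :
    jointTail G H A u = jointTail H G A u := by
  rw [jointTail, jointTail, ← Measure.prod_swap,
    map_measureReal_apply measurable_swap (measurableSet_jointTail A u)]
  congr 1
  ext p
  simp only [Set.mem_preimage, Set.mem_ofPred_eq, Prod.fst_swap, Prod.snd_swap]
  rw [add_comm p.2 p.1]; tauto

/-- `jointTail` is monotone in the tail of the second law, because its sections are half-lines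
beyond `A`. -/
lemma jointTail_le_mul (G : Measure ℝ) {H F : Measure ℝ} [IsFiniteMeasure G] [IsFiniteMeasure H]
    [IsFiniteMeasure F] {A b : ℝ} (hb : 0 ≤ b) (h : ∀ t, A ≤ t → tail H t ≤ b * tail F t)
    (u : ℝ) : jointTail G H A u ≤ b * jointTail G F A u := by
  have h' : ∀ t, A ≤ t → H (Set.Ioi t) ≤ ENNReal.ofReal b * F (Set.Ioi t) := by
    intro t ht
    have := ENNReal.ofReal_le_ofReal (h t ht)
    rwa [ENNReal.ofReal_mul hb, tail, tail, ofReal_measureReal, ofReal_measureReal] at this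
  have hsec : ∀ x : ℝ, Prod.mk x ⁻¹' {p : ℝ × ℝ | A < p.1 ∧ A < p.2 ∧ u < p.1 + p.2} =
      if A < x then Set.Ioi (max A (u - x)) else ∅ := by
    intro x
    ext y
    split_ifs with hx
    · simp only [Set.mem_preimage, Set.mem_ofPred_eq, Set.mem_Ioi, max_lt_iff, sub_lt_iff_lt_add',
        hx, true_and]
    · simp [hx]
  rw [jointTail, jointTail, measureReal_def, measureReal_def, ← ENNReal.toReal_ofReal hb,
    ← ENNReal.toReal_mul]
  refine ENNReal.toReal_mono (ENNReal.mul_ne_top ENNReal.ofReal_ne_top (measure_ne_top _ _)) ?_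
  rw [Measure.prod_apply (measurableSet_jointTail A u),
    Measure.prod_apply (measurableSet_jointTail A u),
    ← lintegral_const_mul' _ _ ENNReal.ofReal_ne_top]
  refine lintegral_mono fun x => ?_
  simp only [hsec]
  split_ifs
  · exact h' _ (le_max_left _ _)
  · simp

/-! ### Subexponential laws -/

section Subexponential

variable {F : Measure ℝ}

lemma IsSubexponential.tail_pos (hF : IsSubexponential F) (u : ℝ) : 0 < tail F u := by
  have := hF.isProbabilityMeasure
  by_contra hu
  have h0 : tail F u = 0 := le_antisymm (not_lt.1 hu) (tail_nonneg _ _)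
  have h1 := hF.tendsto 1 le_rfl
  have h2 : Tendsto (fun u : ℝ => tail (convPow F 1) u / tail F u) atTop (𝓝 0) := by
    refine tendsto_const_nhds.congr' ?_
    filter_upwards [eventually_ge_atTop u] with v hv
    have : tail F v = 0 := le_antisymm (h0 ▸ tail_antitone F hv) (tail_nonneg _ _)
    rw [this, div_zero]
  simpa using tendsto_nhds_unique h1 h2

lemma IsSubexponential.tendsto_conv_self (hF : IsSubexponential F) :
    Tendsto (fun u : ℝ => tail (F.conv F) u / tail F u) atTop (𝓝 2) := by
  have := hF.isProbabilityMeasure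
  have h := hF.tendsto 2 (by norm_num)
  simpa [convPow, Measure.dirac_zero_conv] using h

/-- Subexponential laws are long-tailed: a bounded shift does not change the tail
asymptotically. -/
lemma IsSubexponential.tendsto_shift (hF : IsSubexponential F) {y : ℝ} (hy : 0 ≤ y) :
    Tendsto (fun u : ℝ => tail F (u - y) / tail F u) atTop (𝓝 1) := by
  have := hF.isProbabilityMeasure
  have hpos := hF.tail_pos
  have hone : ∀ v, F.real (Set.Iic v) = 1 - tail F v := fun v => by
    have := real_Iic_add_tail F v
    rw [probReal_univ] at this; linarith
  -- The tail of `F * F` at `u` is bounded below by the mass of the disjoint events `x > u`,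
  -- `x ≤ y, u < x'` and `y < x ≤ u, u - y < x'`.
  have key : ∀ u, y ≤ u → tail F u + (F.real (Set.Iic y)) * tail F u +
      (tail F y - tail F u) * tail F (u - y) ≤ tail (F.conv F) u := by
    intro u hu
    have h3 : tail F y - tail F u = F.real (Set.Ioc y u) := by
      have : F.real (Set.Ioc y u) + tail F u = tail F y := by
        rw [tail, tail, ← measureReal_union _ measurableSet_Ioi, Set.Ioc_union_Ioi_eq_Ioi hu]
        rw [Set.disjoint_left]; intro x hx hx'; exact absurd hx' (not_lt.2 hx.2)
      linarith
    have h4 : tail F u = (F.prod F).real (Set.Ioi u ×ˢ Set.univ) := by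
      rw [measureReal_prod_prod, probReal_univ, mul_one]; rfl
    rw [tail_conv_eq, h3]
    nth_rewrite 1 [h4]
    rw [tail, tail, ← measureReal_prod_prod, ← measureReal_prod_prod, ← measureReal_union,
      ← measureReal_union]
    · refine ENNReal.toReal_mono (measure_ne_top _ _) (measure_mono_ae ?_)
      have h1 : ∀ᵐ p ∂(F.prod F), 0 ≤ p.1 :=
        Measure.quasiMeasurePreserving_fst.ae (ae_nonneg_of_Iio hF.nonneg)
      have h2 : ∀ᵐ p ∂(F.prod F), 0 ≤ p.2 :=
        Measure.quasiMeasurePreserving_snd.ae (ae_nonneg_of_Iio hF.nonneg)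
      filter_upwards [h1, h2] with p hp1 hp2 hp
      change u < p.1 + p.2
      rcases hp with (⟨h, _⟩ | ⟨_, h⟩) | ⟨h, h'⟩
      · have : u < p.1 := h
        linarith
      · have : u < p.2 := h
        linarith
      · have h5 : y < p.1 := h.1
        have h6 : u - y < p.2 := h'
        linarith
    · rw [Set.disjoint_left]
      rintro p (⟨h, _⟩ | ⟨h, _⟩) ⟨h1, _⟩
      · exact absurd h1.2 (not_le.2 h)
      · exact absurd h1.1 (not_lt.2 h)
    · exact measurableSet_Ioc.prod measurableSet_Ioi
    · rw [Set.disjoint_left]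
      rintro p ⟨h, _⟩ ⟨h1, _⟩
      have ha : u < p.1 := h
      have hb : p.1 ≤ y := h1
      linarith
    · exact measurableSet_Iic.prod measurableSet_Ioi
  have hlim : Tendsto (fun u => (tail (F.conv F) u / tail F u - 1 - F.real (Set.Iic y)) /
      (tail F y - tail F u)) atTop (𝓝 1) := by
    have := ((hF.tendsto_conv_self.sub_const 1).sub_const (F.real (Set.Iic y))).div
      ((tendsto_tail_atTop F).const_sub (tail F y)) (by linarith [hpos y])
    convert! this using 2
    rw [hone, sub_zero, eq_comm, div_eq_one_iff_eq (hpos y).ne']; ring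
  refine tendsto_of_tendsto_of_tendsto_of_le_of_le' tendsto_const_nhds hlim ?_ ?_
  · refine Eventually.of_forall fun u => ?_
    rw [le_div_iff₀ (hpos u), one_mul]
    exact tail_antitone F (by linarith)
  · filter_upwards [eventually_ge_atTop y,
      (tendsto_tail_atTop F).eventually_lt_const (hpos y)] with u hu hu'
    rw [le_div_iff₀ (by linarith), div_mul_eq_mul_div, div_sub_one (hpos u).ne', le_sub_iff_add_le,
      le_div_iff₀ (hpos u), add_mul, div_mul_cancel₀ _ (hpos u).ne']
    have := key u hu
    linarith

/-- The tail of a subexponential law decays more slowly than every exponential. -/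
lemma IsSubexponential.tendsto_exp_div (hF : IsSubexponential F) {s : ℝ} (hs : 0 < s) :
    Tendsto (fun u : ℝ => Real.exp (-(s * u)) / tail F u) atTop (𝓝 0) := by
  have := hF.isProbabilityMeasure
  have hpos := hF.tail_pos
  -- From `u₀` on, one unit step costs the tail at most a factor `exp (-s / 2)`.
  have hr : (1 : ℝ) < Real.exp (s / 2) := by simpa using half_pos hs
  obtain ⟨u₀, hu₀⟩ := eventually_atTop.1
    ((hF.tendsto_shift zero_le_one).eventually_lt_const hr)
  have hstep : ∀ u, u₀ ≤ u → Real.exp (-(s / 2)) * tail F (u - 1) ≤ tail F u := by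
    intro u hu
    have := (div_lt_iff₀ (hpos u)).1 (hu₀ u hu)
    rw [Real.exp_neg, inv_mul_le_iff₀ (Real.exp_pos _)]
    exact this.le
  have hiter : ∀ n : ℕ, Real.exp (-(s / 2 * n)) * tail F u₀ ≤ tail F (u₀ + n) := by
    intro n
    induction n with
    | zero => simp
    | succ n ih =>
      have h1 := hstep (u₀ + (n + 1 : ℕ)) (by push_cast; linarith [Nat.cast_nonneg (α := ℝ) n])
      have h2 : u₀ + ((n + 1 : ℕ) : ℝ) - 1 = u₀ + n := by push_cast; ring
      rw [h2] at h1
      refine le_trans ?_ h1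
      have h3 : -(s / 2 * ((n + 1 : ℕ) : ℝ)) = -(s / 2) + -(s / 2 * n) := by push_cast; ring
      rw [h3, Real.exp_add, mul_assoc]
      exact mul_le_mul_of_nonneg_left ih (Real.exp_pos _).le
  have hlow : ∀ u, u₀ ≤ u →
      Real.exp (-(s / 2 * (u - u₀ + 1))) * tail F u₀ ≤ tail F u := by
    intro u hu
    refine le_trans ?_ ((hiter ⌈u - u₀⌉₊).trans
      (tail_antitone F (by linarith [Nat.le_ceil (u - u₀)])))
    refine mul_le_mul_of_nonneg_right (Real.exp_le_exp.2 (neg_le_neg ?_)) (hpos _).le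
    have := (Nat.ceil_lt_add_one (sub_nonneg.2 hu)).le
    exact mul_le_mul_of_nonneg_left this (by linarith)
  have hlim : Tendsto (fun u : ℝ => Real.exp (-(s / 2 * u)) *
      (Real.exp (s / 2 * (1 - u₀)) / tail F u₀)) atTop (𝓝 0) := by
    have h1 : Tendsto (fun u : ℝ => -(s / 2 * u)) atTop atBot :=
      tendsto_neg_atTop_atBot.comp (tendsto_id.const_mul_atTop (half_pos hs))
    simpa using (Real.tendsto_exp_atBot.comp h1).mul_const
      (Real.exp (s / 2 * (1 - u₀)) / tail F u₀)
  refine squeeze_zero' (Eventually.of_forall fun u => div_nonneg (Real.exp_pos _).le (hpos u).le)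
    ?_ hlim
  filter_upwards [eventually_ge_atTop u₀] with u hu
  rw [div_le_iff₀ (hpos u)]
  refine le_trans (le_of_eq ?_)
    (mul_le_mul_of_nonneg_left (hlow u hu) (by have := hpos u₀; positivity))
  have h5 := (hpos u₀).ne'
  field_simp
  rw [← Real.exp_add, ← Real.exp_add]
  congr 1; ring

/-- Asymptotic upper bound for the tail of a convolution, relative to a subexponential law. -/
lemma IsSubexponential.eventually_tail_conv_le (hF : IsSubexponential F) {G H : Measure ℝ}
    [IsFiniteMeasure G] [IsFiniteMeasure H] {a b η : ℝ} (ha : 0 ≤ a) (hb : 0 ≤ b) (hη : 0 < η)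
    (hGa : ∀ᶠ u in atTop, tail G u ≤ a * tail F u) (hHb : ∀ᶠ u in atTop, tail H u ≤ b * tail F u) :
    ∀ᶠ u in atTop, tail (G.conv H) u ≤
      (a * H.real Set.univ + b * G.real Set.univ + η) * tail F u := by
  have := hF.isProbabilityMeasure
  have hpos := hF.tail_pos
  obtain ⟨A₁, hA₁⟩ := eventually_atTop.1 hGa
  obtain ⟨A₂, hA₂⟩ := eventually_atTop.1 hHb
  -- The choice of `A`: the limit of the joint part is `a * b * (2 - 2 * F(A))`.
  have hA : ∀ᶠ A in atTop, a * b * (2 * tail F A) < η := by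
    have := ((tendsto_tail_atTop F).const_mul 2).const_mul (a * b)
    rw [mul_zero, mul_zero] at this
    exact this.eventually_lt_const hη
  obtain ⟨A, hAη, hA0, hAA₁, hAA₂⟩ := (hA.and ((eventually_ge_atTop 0).and
    ((eventually_ge_atTop A₁).and (eventually_ge_atTop A₂)))).exists
  have hJ : ∀ u, jointTail G H A u ≤ a * b * jointTail F F A u := by
    intro u
    calc jointTail G H A u ≤ b * jointTail G F A u :=
          jointTail_le_mul G hb (fun t ht => hA₂ t (hAA₂.trans ht)) u
      _ = b * jointTail F G A u := by rw [jointTail_comm]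
      _ ≤ b * (a * jointTail F F A u) := mul_le_mul_of_nonneg_left
          (jointTail_le_mul F ha (fun t ht => hA₁ t (hAA₁.trans ht)) u) hb
      _ = a * b * jointTail F F A u := by ring
  set g := G.real (Set.Iic A)
  set h := H.real (Set.Iic A)
  have hg : g ≤ G.real Set.univ := measureReal_mono (Set.subset_univ _)
  have hh : h ≤ H.real Set.univ := measureReal_mono (Set.subset_univ _)
  have hlim : Tendsto (fun u => (g * b + h * a) * (tail F (u - A) / tail F u) +
      a * b * (tail (F.conv F) u / tail F u - 2 * F.real (Set.Iic A))) atTop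
      (𝓝 ((g * b + h * a) * 1 + a * b * (2 - 2 * F.real (Set.Iic A)))) :=
    ((hF.tendsto_shift hA0).const_mul _).add
      ((hF.tendsto_conv_self.sub_const _).const_mul _)
  have hlt : (g * b + h * a) * 1 + a * b * (2 - 2 * F.real (Set.Iic A)) <
      a * H.real Set.univ + b * G.real Set.univ + η := by
    have h1 := real_Iic_add_tail F A
    rw [probReal_univ] at h1
    have h2 : 2 - 2 * F.real (Set.Iic A) = 2 * tail F A := by linarith
    rw [h2]
    have h3 := mul_le_mul_of_nonneg_left hg hb
    have h4 := mul_le_mul_of_nonneg_left hh ha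
    linarith
  filter_upwards [hlim.eventually_lt_const hlt, eventually_ge_atTop (2 * A),
    eventually_ge_atTop (A₁ + A), eventually_ge_atTop (A₂ + A)] with u hu hu0 hu1 hu2
  have hFF := le_tail_conv hF.nonneg hF.nonneg hA0 hu0
  have h5 : jointTail F F A u ≤ tail (F.conv F) u - 2 * F.real (Set.Iic A) * tail F u := by
    linarith
  calc tail (G.conv H) u ≤ g * tail H (u - A) + h * tail G (u - A) + jointTail G H A u :=
        tail_conv_le A u
    _ ≤ g * (b * tail F (u - A)) + h * (a * tail F (u - A)) +
        a * b * (tail (F.conv F) u - 2 * F.real (Set.Iic A) * tail F u) := by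
        refine add_le_add (add_le_add ?_ ?_) ((hJ u).trans
          (mul_le_mul_of_nonneg_left h5 (mul_nonneg ha hb)))
        · exact mul_le_mul_of_nonneg_left (hA₂ _ (by linarith)) measureReal_nonneg
        · exact mul_le_mul_of_nonneg_left (hA₁ _ (by linarith)) measureReal_nonneg
    _ = ((g * b + h * a) * (tail F (u - A) / tail F u) +
        a * b * (tail (F.conv F) u / tail F u - 2 * F.real (Set.Iic A))) * tail F u := by
        have := (hpos u).ne'
        field_simp
    _ ≤ _ := mul_le_mul_of_nonneg_right hu.le (hpos u).le

/-- Asymptotic lower bound for the tail of a convolution. -/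
lemma eventually_le_tail_conv {F G H : Measure ℝ} [IsFiniteMeasure G] [IsFiniteMeasure H]
    (hG : G (Set.Iio 0) = 0) (hH : H (Set.Iio 0) = 0) {a b η : ℝ} (hη : 0 < η)
    (hGa : ∀ᶠ u in atTop, a * tail F u ≤ tail G u) (hHb : ∀ᶠ u in atTop, b * tail F u ≤ tail H u) :
    ∀ᶠ u in atTop, (a * H.real Set.univ + b * G.real Set.univ - η) * tail F u ≤
      tail (G.conv H) u := by
  have hlim : Tendsto (fun A => a * H.real (Set.Iic A) + b * G.real (Set.Iic A)) atTop
      (𝓝 (a * H.real Set.univ + b * G.real Set.univ)) :=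
    ((tendsto_real_Iic_atTop H).const_mul a).add ((tendsto_real_Iic_atTop G).const_mul b)
  obtain ⟨A, hA, hA0⟩ := ((hlim.eventually_const_lt (sub_lt_self _ hη)).and
    (eventually_ge_atTop 0)).exists
  filter_upwards [hGa, hHb, eventually_ge_atTop (2 * A)] with u h1 h2 h3
  have h4 := le_tail_conv hG hH hA0 h3
  have h5 : 0 ≤ jointTail G H A u := measureReal_nonneg
  have h6 := mul_le_mul_of_nonneg_right hA.le (tail_nonneg F u)
  have h7 := mul_le_mul_of_nonneg_left h2 (measureReal_nonneg (μ := G) (s := Set.Iic A))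
  have h8 := mul_le_mul_of_nonneg_left h1 (measureReal_nonneg (μ := H) (s := Set.Iic A))
  linarith

lemma eventually_tail_le_of_tendsto (hF : IsSubexponential F) {G : Measure ℝ} {a c : ℝ}
    (h : Tendsto (fun u => tail G u / tail F u) atTop (𝓝 a)) (hc : a < c) :
    ∀ᶠ u in atTop, tail G u ≤ c * tail F u := by
  filter_upwards [h.eventually_lt_const hc] with u hu
  exact ((div_lt_iff₀ (hF.tail_pos u)).1 hu).le

lemma eventually_le_tail_of_tendsto (hF : IsSubexponential F) {G : Measure ℝ} {a c : ℝ}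
    (h : Tendsto (fun u => tail G u / tail F u) atTop (𝓝 a)) (hc : c < a) :
    ∀ᶠ u in atTop, c * tail F u ≤ tail G u := by
  filter_upwards [h.eventually_const_lt hc] with u hu
  exact ((lt_div_iff₀ (hF.tail_pos u)).1 hu).le

lemma tendsto_tail_div_of_bounds (hF : IsSubexponential F) {G : Measure ℝ} {c : ℝ}
    (hup : ∀ η > 0, ∀ᶠ u in atTop, tail G u ≤ (c + η) * tail F u)
    (hlo : ∀ η > 0, ∀ᶠ u in atTop, (c - η) * tail F u ≤ tail G u) :
    Tendsto (fun u => tail G u / tail F u) atTop (𝓝 c) := by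
  rw [Metric.tendsto_nhds]
  intro η hη
  filter_upwards [hup (η / 2) (half_pos hη), hlo (η / 2) (half_pos hη)] with u h1 h2
  have h3 := (div_le_iff₀ (hF.tail_pos u)).2 h1
  have h4 := (le_div_iff₀ (hF.tail_pos u)).2 h2
  rw [Real.dist_eq, abs_lt]
  constructor <;> linarith

lemma nonneg_of_tendsto_tail_div {G : Measure ℝ} {a : ℝ}
    (h : Tendsto (fun u => tail G u / tail F u) atTop (𝓝 a)) : 0 ≤ a :=
  ge_of_tendsto h (Eventually.of_forall fun _ => div_nonneg (tail_nonneg _ _) (tail_nonneg _ _))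

/-- Tails asymptotically proportional to a subexponential one add up under convolution. -/
lemma IsSubexponential.tendsto_tail_conv (hF : IsSubexponential F) {G H : Measure ℝ}
    [IsFiniteMeasure G] [IsFiniteMeasure H] (hG : G (Set.Iio 0) = 0) (hH : H (Set.Iio 0) = 0)
    {a b : ℝ} (ha : Tendsto (fun u => tail G u / tail F u) atTop (𝓝 a))
    (hb : Tendsto (fun u => tail H u / tail F u) atTop (𝓝 b)) :
    Tendsto (fun u => tail (G.conv H) u / tail F u) atTop
      (𝓝 (a * H.real Set.univ + b * G.real Set.univ)) := by
  have ha0 := nonneg_of_tendsto_tail_div ha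
  have hb0 := nonneg_of_tendsto_tail_div hb
  set g := G.real Set.univ
  set h := H.real Set.univ
  have hg : 0 ≤ g := measureReal_nonneg
  have hh : 0 ≤ h := measureReal_nonneg
  -- `σ` is chosen so that `σ * h + σ * g + η / 2 ≤ η`.
  have hσ : ∀ η > 0, ∃ σ > 0, σ * h + σ * g + η / 2 ≤ η := by
    intro η hη
    refine ⟨η / 2 / (h + g + 1), by positivity, ?_⟩
    have : η / 2 / (h + g + 1) * (h + g + 1) = η / 2 := div_mul_cancel₀ _ (by positivity)
    have h2 : 0 < η / 2 / (h + g + 1) := by positivity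
    linarith
  refine tendsto_tail_div_of_bounds hF (fun η hη => ?_) (fun η hη => ?_)
  · obtain ⟨σ, hσ0, hσ⟩ := hσ η hη
    filter_upwards [hF.eventually_tail_conv_le (by positivity) (by positivity) (half_pos hη)
      (eventually_tail_le_of_tendsto hF ha (c := a + σ) (by linarith))
      (eventually_tail_le_of_tendsto hF hb (c := b + σ) (by linarith))] with u hu
    refine hu.trans (mul_le_mul_of_nonneg_right ?_ (tail_nonneg _ _))
    linarith
  · obtain ⟨σ, hσ0, hσ⟩ := hσ η hη
    filter_upwards [eventually_le_tail_conv hG hH (half_pos hη)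
      (eventually_le_tail_of_tendsto hF ha (c := a - σ) (by linarith))
      (eventually_le_tail_of_tendsto hF hb (c := b - σ) (by linarith))] with u hu
    refine le_trans (mul_le_mul_of_nonneg_right ?_ (tail_nonneg _ _)) hu
    linarith

end Subexponential

/-! ### Defective renewal equations -/

/-- A bound `tail ν ≤ b * tail F` on `[0, u]` propagates to the convolution with `K`: the first
summand either exceeds `u`, or leaves a distance in `[0, u]` to the second one. -/
lemma tail_conv_le_of_le_mul {K ν F : Measure ℝ} [IsFiniteMeasure K] [IsProbabilityMeasure ν]
    [IsProbabilityMeasure F] (hK : K (Set.Iio 0) = 0) (hF : F (Set.Iio 0) = 0) {b u : ℝ}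
    (hb : 0 ≤ b) (h : ∀ v, 0 ≤ v → v ≤ u → tail ν v ≤ b * tail F v) :
    tail (K.conv ν) u ≤ tail K u + b * (tail (K.conv F) u - tail K u) := by
  set S : Set (ℝ × ℝ) := {p | p.1 ≤ u ∧ u < p.1 + p.2} with hS
  have hSm : MeasurableSet S := (measurableSet_le measurable_fst measurable_const).inter
    (measurableSet_lt measurable_const (measurable_fst.add measurable_snd))
  have htail : ∀ H : Measure ℝ, [IsProbabilityMeasure H] →
      tail K u = (K.prod H).real (Set.Ioi u ×ˢ Set.univ) := by
    intro H _
    rw [measureReal_prod_prod, probReal_univ, mul_one]; rfl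
  have hsec : ∀ x : ℝ, Prod.mk x ⁻¹' S = if x ≤ u then Set.Ioi (u - x) else ∅ := by
    intro x
    ext y
    split_ifs with hx
    · simp [hS, hx, sub_lt_iff_lt_add']
    · simp [hS, hx]
  have hsub : (K.prod ν).real S ≤ b * (K.prod F).real S := by
    rw [measureReal_def, measureReal_def, ← ENNReal.toReal_ofReal hb, ← ENNReal.toReal_mul]
    refine ENNReal.toReal_mono (ENNReal.mul_ne_top ENNReal.ofReal_ne_top (measure_ne_top _ _)) ?_
    rw [Measure.prod_apply hSm, Measure.prod_apply hSm,
      ← lintegral_const_mul' _ _ ENNReal.ofReal_ne_top]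
    refine lintegral_mono_ae ?_
    filter_upwards [ae_nonneg_of_Iio hK] with x hx
    rw [hsec]
    split_ifs with hxu
    · have h2 := ENNReal.ofReal_le_ofReal (h (u - x) (by linarith) (by linarith))
      rwa [ENNReal.ofReal_mul hb, tail, tail, ofReal_measureReal, ofReal_measureReal] at h2
    · simp
  have hup : tail (K.conv ν) u ≤ tail K u + (K.prod ν).real S := by
    rw [tail_conv_eq, htail ν]
    refine le_trans (measureReal_mono ?_) (measureReal_union_le _ _)
    intro p hp
    rcases le_or_gt p.1 u with h1 | h1
    · exact Or.inr ⟨h1, hp⟩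
    · exact Or.inl ⟨h1, trivial⟩
  have hlo : tail K u + (K.prod F).real S ≤ tail (K.conv F) u := by
    rw [tail_conv_eq, htail F, ← measureReal_union _ hSm]
    · refine ENNReal.toReal_mono (measure_ne_top _ _) (measure_mono_ae ?_)
      have h2 : ∀ᵐ p ∂(K.prod F), 0 ≤ p.2 :=
        Measure.quasiMeasurePreserving_snd.ae (ae_nonneg_of_Iio hF)
      filter_upwards [h2] with p hp2 hp
      rcases hp with ⟨h, _⟩ | h
      · have h' : u < p.1 := h
        change u < p.1 + p.2
        linarith
      · exact h.2
    · rw [Set.disjoint_left]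
      rintro p ⟨h, _⟩ ⟨h1, _⟩
      exact absurd h (not_lt.2 h1)
  have := mul_le_mul_of_nonneg_left (le_sub_iff_add_le'.2 hlo) hb
  linarith

/-- A solution of a defective renewal equation whose kernel has a tail of the order of a
subexponential one has itself a tail of at most that order. -/
lemma IsSubexponential.exists_tail_le_of_renewal {F : Measure ℝ} (hF : IsSubexponential F)
    {ν K : Measure ℝ} [IsProbabilityMeasure ν] [IsFiniteMeasure K] (hK : K (Set.Iio 0) = 0)
    (hρ : K.real Set.univ < 1) {k : ℝ}
    (hk : Tendsto (fun u => tail K u / tail F u) atTop (𝓝 k))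
    (hren : ∀ u, 0 ≤ u → tail ν u = tail (K.conv ν) u) :
    ∃ a, 0 ≤ a ∧ ∀ u, 0 ≤ u → tail ν u ≤ a * tail F u := by
  have := hF.isProbabilityMeasure
  have hpos := hF.tail_pos
  have hself : Tendsto (fun u => tail F u / tail F u) atTop (𝓝 1) := by
    refine tendsto_const_nhds.congr fun u => ?_
    rw [div_self (hpos u).ne']
  have hlim : Tendsto (fun u => tail (K.conv F) u / tail F u - tail K u / tail F u) atTop
      (𝓝 (K.real Set.univ)) := by
    have := (hF.tendsto_tail_conv hK hF.nonneg hk hself).sub hk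
    rw [probReal_univ] at this
    convert! this using 2
    ring
  obtain ⟨r, hr, hr1⟩ := exists_between hρ
  have hr0 : 0 < r := measureReal_nonneg.trans_lt hr
  obtain ⟨T, hT⟩ := eventually_atTop.1 ((hlim.eventually_lt_const hr).and
    (hk.eventually_lt_const (lt_add_one k)))
  have hk0 := nonneg_of_tendsto_tail_div hk
  have hstep : ∀ b u, 0 ≤ b → T ≤ u → 0 ≤ u →
      (∀ v, 0 ≤ v → v ≤ u → tail ν v ≤ b * tail F v) →
      tail ν u ≤ (k + 1 + r * b) * tail F u := by
    intro b u hb hTu hu h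
    rw [hren u hu]
    refine (tail_conv_le_of_le_mul hK hF.nonneg hb h).trans ?_
    obtain ⟨h1, h2⟩ := hT u hTu
    rw [← sub_div, div_lt_iff₀ (hpos u)] at h1
    rw [div_lt_iff₀ (hpos u)] at h2
    have := mul_le_mul_of_nonneg_left h1.le hb
    linarith
  refine ⟨max (1 / tail F T) ((k + 1) / (1 - r)), ?_, ?_⟩
  · exact le_max_of_le_left (one_div_nonneg.2 (hpos T).le)
  -- The least constant that works on `[0, U]` is bounded independently of `U`.
  intro U hU
  set q : ℝ → ℝ := fun u => tail ν u / tail F u with hq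
  have hbdd : BddAbove (q '' Set.Icc 0 U) := by
    refine ⟨1 / tail F U, ?_⟩
    rintro _ ⟨u, hu, rfl⟩
    exact div_le_div₀ zero_le_one (by simpa using tail_le_univ ν u) (hpos U)
      (tail_antitone F hu.2)
  set s := sSup (q '' Set.Icc 0 U) with hs
  have hqs : ∀ v, 0 ≤ v → v ≤ U → tail ν v ≤ s * tail F v := fun v h0 h1 =>
    (div_le_iff₀ (hpos v)).1 (le_csSup hbdd ⟨v, ⟨h0, h1⟩, rfl⟩)
  have hs0 : 0 ≤ s := le_csSup_of_le hbdd ⟨0, ⟨le_rfl, hU⟩, rfl⟩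
    (div_nonneg (tail_nonneg _ _) (tail_nonneg _ _))
  have hmax : s ≤ max (1 / tail F T) (k + 1 + r * s) := by
    refine csSup_le ⟨_, ⟨0, ⟨le_rfl, hU⟩, rfl⟩⟩ ?_
    rintro _ ⟨u, hu, rfl⟩
    rcases le_total T u with h | h
    · exact le_max_of_le_right ((div_le_iff₀ (hpos u)).2
        (hstep s u hs0 h hu.1 fun v h0 h1 => hqs v h0 (h1.trans hu.2)))
    · exact le_max_of_le_left (div_le_div₀ zero_le_one (by simpa using tail_le_univ ν u) (hpos T)
        (tail_antitone F h))
  refine (hqs U hU le_rfl).trans (mul_le_mul_of_nonneg_right ?_ (hpos U).le)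
  rcases le_max_iff.1 hmax with h | h
  · exact le_max_of_le_left h
  · refine le_max_of_le_right ((le_div_iff₀ (by linarith)).2 ?_)
    linarith

/-- **Tail asymptotics for a defective renewal equation** `ν = (1 - ρ) δ₀ + K * ν`, `ρ = |K| < 1`:
if the tail of `K` is asymptotically `k` times a subexponential tail (`k = 0` allowed), then that
of `ν` is asymptotically `k / (1 - ρ)` times it. -/
theorem IsSubexponential.tendsto_tail_of_renewal {F : Measure ℝ} (hF : IsSubexponential F)
    {ν K : Measure ℝ} [IsProbabilityMeasure ν] [IsFiniteMeasure K]
    (hν : ν (Set.Iio 0) = 0) (hK : K (Set.Iio 0) = 0) (hρ : K.real Set.univ < 1) {k : ℝ}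
    (hk : Tendsto (fun u => tail K u / tail F u) atTop (𝓝 k))
    (hren : ∀ u, 0 ≤ u → tail ν u = tail (K.conv ν) u) :
    Tendsto (fun u => tail ν u / tail F u) atTop (𝓝 (k / (1 - K.real Set.univ))) := by
  have hk0 := nonneg_of_tendsto_tail_div hk
  set ρ := K.real Set.univ
  have hρ0 : 0 ≤ ρ := measureReal_nonneg
  have h1ρ : 0 < 1 - ρ := by linarith
  obtain ⟨a, ha0, ha⟩ := hF.exists_tail_le_of_renewal hK hρ hk hren
  have hpow : ∀ c : ℝ, Tendsto (fun n : ℕ => ρ ^ n * c) atTop (𝓝 0) := fun c => by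
    simpa using (tendsto_pow_atTop_nhds_zero_of_lt_one hρ0 hρ).mul_const c
  -- Inserting a bound into the renewal equation moves it to the fixed point at rate `ρ`.
  refine tendsto_tail_div_of_bounds hF (fun η hη => ?_) (fun η hη => ?_)
  · set τ := η / 2 * (1 - ρ) / 2 with hτdef
    have hτ : 0 < τ := by positivity
    have hind : ∀ n : ℕ, ∀ᶠ u in atTop,
        tail ν u ≤ ((k + 2 * τ) / (1 - ρ) + ρ ^ n * a) * tail F u := by
      intro n
      induction n with
      | zero =>
        filter_upwards [eventually_ge_atTop 0] with u hu
        refine (ha u hu).trans (mul_le_mul_of_nonneg_right ?_ (tail_nonneg _ _))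
        have : 0 ≤ (k + 2 * τ) / (1 - ρ) := by positivity
        simpa using this
      | succ n ih =>
        filter_upwards [hF.eventually_tail_conv_le (by positivity) (by positivity) hτ
          (eventually_tail_le_of_tendsto hF hk (c := k + τ) (by linarith)) ih,
          eventually_ge_atTop 0] with u hu hu0
        rw [hren u hu0]
        refine hu.trans (le_of_eq ?_)
        rw [probReal_univ]
        congr 1
        change (k + τ) * 1 + ((k + 2 * τ) / (1 - ρ) + ρ ^ n * a) * ρ + τ = _
        field_simp
        ring
    obtain ⟨n, hn⟩ := ((hpow a).eventually_lt_const (half_pos hη)).exists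
    filter_upwards [hind n] with u hu
    refine hu.trans (mul_le_mul_of_nonneg_right ?_ (tail_nonneg _ _))
    have : (k + 2 * τ) / (1 - ρ) = k / (1 - ρ) + η / 2 := by
      rw [hτdef]; field_simp
    linarith
  · set τ := η / 2 * (1 - ρ) / 2 with hτdef
    have hτ : 0 < τ := by positivity
    set c := (k - 2 * τ) / (1 - ρ) with hc
    have hind : ∀ n : ℕ, ∀ᶠ u in atTop, (c - ρ ^ n * c) * tail F u ≤ tail ν u := by
      intro n
      induction n with
      | zero => exact Eventually.of_forall fun u => by simpa using tail_nonneg ν u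
      | succ n ih =>
        filter_upwards [eventually_le_tail_conv hK hν hτ
          (eventually_le_tail_of_tendsto hF hk (c := k - τ) (by linarith)) ih,
          eventually_ge_atTop 0] with u hu hu0
        rw [hren u hu0]
        refine le_trans (le_of_eq ?_) hu
        rw [probReal_univ]
        congr 1
        change _ = (k - τ) * 1 + (c - ρ ^ n * c) * ρ - τ
        have : k - 2 * τ = c * (1 - ρ) := (div_mul_cancel₀ _ h1ρ.ne').symm
        linear_combination - this
    obtain ⟨n, hn⟩ := ((hpow c).eventually_lt_const (half_pos hη)).exists
    filter_upwards [hind n] with u hu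
    refine le_trans (mul_le_mul_of_nonneg_right ?_ (tail_nonneg _ _)) hu
    have : c = k / (1 - ρ) - η / 2 := by
      rw [hc, hτdef]; field_simp
    linarith

/-! ### Phase-type laws have exponentially decaying tails -/

section PhaseType

attribute [local instance] Matrix.linftyOpNormedRing Matrix.linftyOpNormedAlgebra

variable {m : ℕ}

lemma exp_nonneg_of_nonneg {A : Matrix (Fin m) (Fin m) ℝ} (hA : ∀ i j, 0 ≤ A i j) (i j : Fin m) :
    0 ≤ NormedSpace.exp A i j := by
  have hs := NormedSpace.exp_series_hasSum_exp' (𝕂 := ℝ) A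
  have hs2 := (Pi.hasSum.1 (Pi.hasSum.1 hs i)) j
  have hpow : ∀ n : ℕ, ∀ i j, 0 ≤ (A ^ n) i j := by
    intro n
    induction n with
    | zero => intro i j; rw [pow_zero, Matrix.one_apply]; split_ifs <;> simp
    | succ n ih =>
      intro i j
      rw [pow_succ, Matrix.mul_apply]
      exact Finset.sum_nonneg fun l _ => mul_nonneg (ih i l) (hA l j)
  refine hs2.nonneg fun n => ?_
  simp only [Matrix.smul_apply, smul_eq_mul]
  exact mul_nonneg (by positivity) (hpow n i j)

/-- The exponential of a matrix with nonnegative off-diagonal entries is nonnegative: shift the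
diagonal by a multiple of the identity, which only rescales the exponential. -/
lemma exp_nonneg_of_offDiag_nonneg {T : Matrix (Fin m) (Fin m) ℝ}
    (hT : ∀ i j, i ≠ j → 0 ≤ T i j) {x : ℝ} (hx : 0 ≤ x) (i j : Fin m) :
    0 ≤ NormedSpace.exp (x • T) i j := by
  obtain ⟨c, hc⟩ : ∃ c : ℝ, ∀ i, 0 ≤ T i i + c :=
    ⟨∑ i, |T i i|, fun i => by
      have h1 : |T i i| ≤ ∑ i, |T i i| := Finset.single_le_sum (f := fun i => |T i i|)
        (fun i _ => abs_nonneg _) (Finset.mem_univ i)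
      have h2 := neg_abs_le (T i i)
      linarith⟩
  have hsplit : x • T = (-(x * c)) • (1 : Matrix (Fin m) (Fin m) ℝ) + x • (T + c • 1) := by
    rw [smul_add, smul_smul, neg_smul]; abel
  have hcomm : Commute ((-(x * c)) • (1 : Matrix (Fin m) (Fin m) ℝ)) (x • (T + c • 1)) :=
    (Commute.one_left _).smul_left _
  have hexp1 : NormedSpace.exp ((-(x * c)) • (1 : Matrix (Fin m) (Fin m) ℝ)) =
      Real.exp (-(x * c)) • (1 : Matrix (Fin m) (Fin m) ℝ) := by
    rw [← Algebra.algebraMap_eq_smul_one, ← Algebra.algebraMap_eq_smul_one, Real.exp_eq_exp_ℝ]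
    exact (NormedSpace.algebraMap_exp_comm _).symm
  rw [hsplit, Matrix.exp_add_of_commute _ _ hcomm, hexp1, Matrix.smul_mul, one_mul,
    Matrix.smul_apply, smul_eq_mul]
  refine mul_nonneg (Real.exp_pos _).le (exp_nonneg_of_nonneg (fun i j => ?_) i j)
  rw [Matrix.smul_apply, smul_eq_mul, Matrix.add_apply, Matrix.smul_apply, smul_eq_mul,
    Matrix.one_apply]
  refine mul_nonneg hx ?_
  split_ifs with h
  · subst h; simpa using hc i
  · simpa using hT i j h

/-- The vector of survival probabilities `exp (x T) 1`. -/
noncomputable def survival (T : Matrix (Fin m) (Fin m) ℝ) (x : ℝ) : Fin m → ℝ :=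
  Matrix.mulVec (NormedSpace.exp (x • T)) (fun _ => 1)

lemma survival_add (T : Matrix (Fin m) (Fin m) ℝ) (x y : ℝ) :
    survival T (x + y) = Matrix.mulVec (NormedSpace.exp (x • T)) (survival T y) := by
  rw [survival, survival, Matrix.mulVec_mulVec, add_smul, Matrix.exp_add_of_commute _ _ ?_]
  exact ((Commute.refl T).smul_left x).smul_right y

lemma survival_zero (T : Matrix (Fin m) (Fin m) ℝ) : survival T 0 = fun _ => 1 := by
  rw [survival, zero_smul, NormedSpace.exp_zero, Matrix.one_mulVec]

lemma hasDerivAt_exp_mulVec (T : Matrix (Fin m) (Fin m) ℝ) (w : Fin m → ℝ) (x : ℝ) (i : Fin m) :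
    HasDerivAt (fun x : ℝ => Matrix.mulVec (NormedSpace.exp (x • T)) w i)
      (Matrix.mulVec (NormedSpace.exp (x • T)) (Matrix.mulVec T w) i) x := by
  have h := hasDerivAt_exp_smul_const (𝕂 := ℝ) T x
  let L : Matrix (Fin m) (Fin m) ℝ →ₗ[ℝ] ℝ :=
    { toFun := fun A => Matrix.mulVec A w i
      map_add' := fun A B => by rw [Matrix.add_mulVec]; rfl
      map_smul' := fun c A => by rw [Matrix.smul_mulVec]; rfl }
  have h2 := (LinearMap.toContinuousLinearMap L).hasFDerivAt.comp_hasDerivAt x h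
  rw [Matrix.mulVec_mulVec]
  exact h2

variable {T : Matrix (Fin m) (Fin m) ℝ}

lemma survival_nonneg (hT : ∀ i j, i ≠ j → 0 ≤ T i j) {x : ℝ} (hx : 0 ≤ x) (i : Fin m) :
    0 ≤ survival T x i := by
  simp only [survival, Matrix.mulVec, dotProduct]
  exact Finset.sum_nonneg fun j _ => mul_nonneg (exp_nonneg_of_offDiag_nonneg hT hx i j) zero_le_one

lemma survival_antitoneOn (hT : ∀ i j, i ≠ j → 0 ≤ T i j) (hrow : ∀ i, ∑ j, T i j ≤ 0)
    (i : Fin m) : AntitoneOn (fun x => survival T x i) (Set.Ici 0) := by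
  refine antitoneOn_of_hasDerivWithinAt_nonpos (convex_Ici 0)
    (f' := fun x => Matrix.mulVec (NormedSpace.exp (x • T)) (Matrix.mulVec T fun _ => 1) i)
    (fun x _ => (hasDerivAt_exp_mulVec T _ x i).continuousAt.continuousWithinAt)
    (fun x _ => (hasDerivAt_exp_mulVec T _ x i).hasDerivWithinAt) fun x hx => ?_
  have hx0 : 0 ≤ x := interior_subset hx
  rw [Matrix.mulVec, dotProduct]
  refine Finset.sum_nonpos fun j _ =>
    mul_nonpos_of_nonneg_of_nonpos (exp_nonneg_of_offDiag_nonneg hT hx0 i j) ?_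
  simpa [Matrix.mulVec, dotProduct] using hrow j

/-- Absorption is certain: the limit `v` of the survival probabilities is invariant under
`exp (y T)`, hence `T v = 0`, and `T` is invertible. -/
lemma tendsto_survival (hT : ∀ i j, i ≠ j → 0 ≤ T i j) (hrow : ∀ i, ∑ j, T i j ≤ 0)
    (hdet : T.det ≠ 0) (i : Fin m) : Tendsto (fun x => survival T x i) atTop (𝓝 0) := by
  have hex : ∀ i, ∃ l, Tendsto (fun x => survival T x i) atTop (𝓝 l) := by
    intro i
    have hanti : Antitone fun x : ℝ => survival T (max x 0) i := fun x y hxy =>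
      survival_antitoneOn hT hrow i 
        (Set.mem_Ici.2 (le_max_right _ _)) (Set.mem_Ici.2 (le_max_right _ _)) (max_le_max_right 0 hxy)
    refine ⟨_, (tendsto_atTop_ciInf hanti ⟨0, ?_⟩).congr' ?_⟩
    · rintro _ ⟨x, rfl⟩
      exact survival_nonneg hT (le_max_right _ _) i
    · filter_upwards [eventually_ge_atTop 0] with x hx
      rw [max_eq_left hx]
  choose v hv using hex
  have hvec : Tendsto (survival T) atTop (𝓝 v) := tendsto_pi_nhds.2 hv
  have hinv : ∀ y : ℝ, Matrix.mulVec (NormedSpace.exp (y • T)) v = v := by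
    intro y
    have h1 : Tendsto (fun x => survival T (y + x)) atTop (𝓝 v) :=
      hvec.comp (tendsto_atTop_add_const_left _ y tendsto_id)
    simp only [survival_add] at h1
    have h2 : Continuous fun w : Fin m → ℝ => Matrix.mulVec (NormedSpace.exp (y • T)) w := by
      fun_prop
    exact tendsto_nhds_unique ((h2.tendsto v).comp hvec) h1
  have hTv : Matrix.mulVec T v = 0 := by
    ext j
    have h1 := hasDerivAt_exp_mulVec T v 0 j
    simp only [hinv, zero_smul, NormedSpace.exp_zero, Matrix.one_mulVec] at h1
    exact h1.unique (hasDerivAt_const _ _)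
  have hv0 : v = 0 := Matrix.eq_zero_of_mulVec_eq_zero hdet hTv
  simpa [hv0] using hv i

end PhaseType

/-- The tail of a phase-type law decays exponentially. -/
theorem IsPhaseType.exists_tail_le_exp {μ : Measure ℝ} (hμ : IsPhaseType μ) :
    ∃ A s : ℝ, 0 < s ∧ ∀ x, 0 ≤ x → tail μ x ≤ A * Real.exp (-(s * x)) := by
  obtain ⟨m, α, T, hα, -, hT, hrow, hdet, htail⟩ := hμ.representation
  have h1 : ∀ᶠ x : ℝ in atTop, ∀ i, survival T x i < Real.exp (-1) :=
    eventually_all.2 fun i =>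
      (tendsto_survival hT hrow hdet i).eventually_lt_const (Real.exp_pos _)
  obtain ⟨x₀, hx₀, hx₀'⟩ := (h1.and (eventually_gt_atTop 0)).exists
  have hmono : ∀ x : ℝ, 0 ≤ x → ∀ (w : Fin m → ℝ) (c : ℝ), (∀ i, w i ≤ c) → ∀ i,
      Matrix.mulVec (NormedSpace.exp (x • T)) w i ≤ c * survival T x i := by
    intro x hx w c hw i
    simp only [survival, Matrix.mulVec, dotProduct, Finset.mul_sum, mul_one]
    refine Finset.sum_le_sum fun j _ => ?_
    rw [mul_comm]
    exact mul_le_mul_of_nonneg_right (hw j) (exp_nonneg_of_offDiag_nonneg hT hx i j)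
  have hgeo : ∀ n : ℕ, ∀ i, survival T (n * x₀) i ≤ Real.exp (-n) := by
    intro n
    induction n with
    | zero => intro i; simp [survival_zero]
    | succ n ih =>
      intro i
      have h2 : ((n + 1 : ℕ) : ℝ) * x₀ = x₀ + n * x₀ := by push_cast; ring
      rw [h2, survival_add]
      refine (hmono x₀ hx₀'.le _ _ ih i).trans ?_
      have h3 : (-((n + 1 : ℕ) : ℝ)) = -n + -1 := by push_cast; ring
      rw [h3, Real.exp_add]
      exact mul_le_mul_of_nonneg_left (hx₀ i).le (Real.exp_pos _).le
  refine ⟨(∑ i, α i) * Real.exp 1, 1 / x₀, by positivity, fun x hx => ?_⟩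
  have hsurv : ∀ i, survival T x i ≤ Real.exp 1 * Real.exp (-(1 / x₀ * x)) := by
    intro i
    have hfl : (⌊x / x₀⌋₊ : ℝ) * x₀ ≤ x :=
      (le_div_iff₀ hx₀').1 (Nat.floor_le (by positivity))
    refine (survival_antitoneOn hT hrow i (Set.mem_Ici.2 (by positivity)) hx hfl).trans
      ((hgeo _ i).trans ?_)
    rw [← Real.exp_add]
    refine Real.exp_le_exp.2 ?_
    have := Nat.lt_floor_add_one (x / x₀)
    rw [one_div_mul_eq_div]
    linarith
  rw [htail x hx]
  change dotProduct α (survival T x) ≤ _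
  rw [dotProduct, mul_assoc, Finset.sum_mul]
  exact Finset.sum_le_sum fun i _ => mul_le_mul_of_nonneg_left (hsurv i) (hα i)

/-! ### The random walk embedded at claim arrivals -/

/-- The claim surplus just after the first `n` claims. -/
def walk (ω : Path) (n : ℕ) : ℝ := ∑ i ∈ Finset.range n, ((ω i).2 - (ω i).1)

/-- The supremum of the embedded random walk, as a real number; it is the supremum of the surplus
process on the almost sure event that the walk is bounded above. -/
noncomputable def supWalk (ω : Path) : ℝ := ⨆ n, walk ω n

@[simp] lemma walk_zero (ω : Path) : walk ω 0 = 0 := by simp [walk]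

lemma walk_succ_eq (ω : Path) (n : ℕ) :
    walk ω (n + 1) = (∑ i ∈ Finset.range (n + 1), (ω i).2) - arrivalTime ω n := by
  rw [walk, arrivalTime, Finset.sum_sub_distrib]

@[fun_prop]
lemma measurable_walk (n : ℕ) : Measurable fun ω => walk ω n := by
  unfold walk; fun_prop

@[fun_prop]
lemma measurable_supWalk : Measurable supWalk := Measurable.iSup measurable_walk

lemma supWalk_nonneg {ω : Path} (h : BddAbove (Set.range (walk ω))) : 0 ≤ supWalk ω :=
  (walk_zero ω).symm.le.trans (le_ciSup h 0)

/-- Between claims the surplus decreases, so its supremum is the supremum of its values at time `0`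
and at claim arrivals. -/
lemma maxSurplus_eq_supWalk {ω : Path} (hT : ∀ i, 0 ≤ (ω i).1) (hX : ∀ i, 0 ≤ (ω i).2)
    (harr : Tendsto (arrivalTime ω) atTop atTop) (hbdd : BddAbove (Set.range (walk ω))) :
    maxSurplus ω = ((supWalk ω : ℝ) : EReal) := by
  have hmono : Monotone (arrivalTime ω) := monotone_nat_of_le_succ fun n => by
    rw [arrivalTime, arrivalTime, Finset.sum_range_succ _ (n + 1)]
    linarith [hT (n + 1)]
  have hXmono : Monotone fun n => ∑ i ∈ Finset.range n, (ω i).2 := monotone_nat_of_le_succ fun n => by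
    rw [Finset.sum_range_succ]
    linarith [hX n]
  have hfin : ∀ t : ℝ, {n : ℕ | arrivalTime ω n ≤ t}.Finite := by
    intro t
    obtain ⟨N, hN⟩ := eventually_atTop.1 (harr.eventually_gt_atTop t)
    refine (Set.finite_Iio N).subset fun n hn => ?_
    by_contra h
    exact absurd hn (not_le.2 (hN n (not_lt.1 h)))
  have hcount : ∀ (t : ℝ) (n : ℕ), arrivalTime ω n ≤ t → n + 1 ≤ claimCount ω t := by
    intro t n hn
    have h1 : (Set.Iio (n + 1)) ⊆ {n : ℕ | arrivalTime ω n ≤ t} := fun k hk =>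
      (hmono (Nat.lt_succ_iff.1 hk)).trans hn
    have h2 := Set.ncard_le_ncard h1 (hfin t)
    rwa [← Finset.coe_Iio, Set.ncard_coe_finset, Nat.card_Iio] at h2
  have hlast : ∀ (t : ℝ) (n : ℕ), claimCount ω t = n + 1 → arrivalTime ω n ≤ t := by
    intro t n hn
    by_contra h
    have h1 : {n : ℕ | arrivalTime ω n ≤ t} ⊆ Set.Iio n := fun k hk => by
      by_contra hkn
      exact h ((hmono (not_lt.1 hkn)).trans hk)
    have h2 := Set.ncard_le_ncard h1 (Set.finite_Iio n)
    rw [← Finset.coe_Iio, Set.ncard_coe_finset, Nat.card_Iio] at h2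
    have h3 : claimCount ω t ≤ n := h2
    omega
  have harr0 : ∀ n, 0 ≤ arrivalTime ω n := fun n => Finset.sum_nonneg fun i _ => hT i
  apply le_antisymm
  · refine iSup_le fun t => EReal.coe_le_coe_iff.2 ?_
    obtain ⟨t, ht⟩ := t
    rcases hn : claimCount ω t with _ | n
    · have : surplus ω t ≤ 0 := by simp [surplus, hn, ht]
      exact this.trans (supWalk_nonneg hbdd)
    · refine le_trans ?_ (le_ciSup hbdd (n + 1))
      rw [surplus, hn, walk_succ_eq]
      linarith [hlast t n hn]
  · have hle : ∀ n, ((walk ω n : ℝ) : EReal) ≤ maxSurplus ω := by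
      intro n
      rcases n with _ | n
      · refine le_trans (EReal.coe_le_coe_iff.2 ?_)
          (le_iSup (fun t : {t : ℝ // 0 ≤ t} => ((surplus ω t : ℝ) : EReal)) ⟨0, le_rfl⟩)
        rw [walk_zero, surplus, sub_zero]
        exact Finset.sum_nonneg fun i _ => hX i
      · refine le_trans (EReal.coe_le_coe_iff.2 ?_)
          (le_iSup (fun t : {t : ℝ // 0 ≤ t} => ((surplus ω t : ℝ) : EReal))
            ⟨arrivalTime ω n, harr0 n⟩)
        rw [walk_succ_eq, surplus]
        exact sub_le_sub_right (hXmono (hcount _ n le_rfl)) _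
    rcases h : maxSurplus ω with _ | _ | m
    · have h0 := hle 0
      rw [h] at h0
      exact absurd h0 (not_le.2 (EReal.bot_lt_coe _))
    · exact le_top
    · rw [h] at hle
      exact EReal.coe_le_coe_iff.2 (ciSup_le fun n => EReal.coe_le_coe_iff.1 (hle n))

/-- Prepending an inter-arrival time and a claim to an outcome. -/
def consPath (p : (ℝ × ℝ) × Path) : Path := fun n => Nat.casesOn n p.1 p.2

@[simp] lemma consPath_zero (p : (ℝ × ℝ) × Path) : consPath p 0 = p.1 := rfl

@[simp] lemma consPath_succ (p : (ℝ × ℝ) × Path) (n : ℕ) : consPath p (n + 1) = p.2 n := rfl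

@[fun_prop]
lemma measurable_consPath : Measurable consPath := by
  refine measurable_pi_lambda _ fun n => ?_
  cases n with
  | zero => exact measurable_fst
  | succ n => exact (measurable_pi_apply n).comp measurable_snd

/-- The recursion satisfied by the supremum of the walk. -/
lemma supWalk_consPath (x : ℝ × ℝ) {ω : Path} (h : BddAbove (Set.range (walk ω))) :
    supWalk (consPath (x, ω)) = max 0 (x.2 - x.1 + supWalk ω) := by
  have hw : ∀ n, walk (consPath (x, ω)) (n + 1) = x.2 - x.1 + walk ω n := by
    intro n
    rw [walk, Finset.sum_range_succ']
    simp only [consPath_succ, consPath_zero]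
    rw [add_comm]; rfl
  have hle : ∀ n, walk (consPath (x, ω)) n ≤ max 0 (x.2 - x.1 + supWalk ω) := by
    intro n
    rcases n with _ | n
    · simp
    · rw [hw]
      have := le_ciSup h n
      exact le_max_of_le_right (by unfold supWalk; linarith)
  have hbdd : BddAbove (Set.range (walk (consPath (x, ω)))) :=
    ⟨_, by rintro _ ⟨n, rfl⟩; exact hle n⟩
  refine le_antisymm (ciSup_le hle) (max_le (supWalk_nonneg hbdd) ?_)
  rw [← le_sub_iff_add_le']
  refine ciSup_le fun n => ?_
  have := le_ciSup hbdd (n + 1)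
  rw [hw] at this
  unfold supWalk
  linarith

/-- The law of an i.i.d. sequence is invariant under prepending an independent copy. -/
lemma map_consPath (Q : Measure (ℝ × ℝ)) [IsProbabilityMeasure Q] :
    (Q.prod (Measure.infinitePi fun _ : ℕ => Q)).map consPath =
      Measure.infinitePi fun _ : ℕ => Q := by
  classical
  refine Measure.eq_infinitePi _ fun s t ht => ?_
  rw [Measure.map_apply measurable_consPath
    (MeasurableSet.pi s.countable_toSet fun i _ => ht i)]
  set s' : Finset ℕ := s.preimage Nat.succ Nat.succ_injective.injOn
  have hpre : consPath ⁻¹' (Set.pi (s : Set ℕ) t) =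
      (if 0 ∈ s then t 0 else Set.univ) ×ˢ Set.pi (s' : Set ℕ) fun n => t (n + 1) := by
    ext ⟨x, ω⟩
    simp only [Set.mem_preimage, Set.mem_pi, Set.mem_prod, SetLike.mem_coe, s',
      Finset.mem_preimage]
    constructor
    · intro h
      refine ⟨?_, fun n hn => h (n + 1) hn⟩
      split_ifs with h0
      · exact h 0 h0
      · trivial
    · rintro ⟨h0, h1⟩ n hn
      rcases n with _ | n
      · rw [if_pos hn] at h0; exact h0
      · exact h1 n hn
  rw [hpre, Measure.prod_prod, Measure.infinitePi_pi _ fun i _ => ht (i + 1)]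
  have hs' : ∏ i ∈ s', Q (t (i + 1)) = ∏ i ∈ s.erase 0, Q (t i) := by
    rw [Finset.prod_preimage' Nat.succ s Nat.succ_injective.injOn fun n => Q (t n)]
    refine Finset.prod_congr ?_ fun _ _ => rfl
    ext n
    rcases n with _ | n <;> simp
  rw [hs']
  by_cases h0 : 0 ∈ s
  · rw [if_pos h0, Finset.mul_prod_erase s (fun n => Q (t n)) h0]
  · rw [if_neg h0, measure_univ, one_mul, Finset.erase_eq_of_notMem h0]

/-- The strong law of large numbers for functions of the coordinates of an i.i.d. sequence. -/
lemma ae_tendsto_average (Q : Measure (ℝ × ℝ)) [IsProbabilityMeasure Q] {f : ℝ × ℝ → ℝ}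
    (hf : Measurable f) (hint : Integrable f Q) :
    ∀ᵐ ω ∂(Measure.infinitePi fun _ : ℕ => Q),
      Tendsto (fun n : ℕ => (∑ i ∈ Finset.range n, f (ω i)) / n) atTop (𝓝 (∫ x, f x ∂Q)) := by
  set P := Measure.infinitePi fun _ : ℕ => Q
  have hmp : ∀ i, MeasurePreserving (fun ω : Path => ω i) P Q := fun i =>
    measurePreserving_eval_infinitePi (fun _ : ℕ => Q) i
  have h := strong_law_ae_real (μ := P) (fun i ω => f (ω i))
    ((hmp 0).integrable_comp_of_integrable hint) ?_ ?_
  · have hI : ∫ ω, f (ω 0) ∂P = ∫ x, f x ∂Q := by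
      rw [← (hmp 0).map_eq, integral_map (hmp 0).measurable.aemeasurable
        hf.aestronglyMeasurable]
    rwa [hI] at h
  · intro i j hij
    exact (iIndepFun_infinitePi (P := fun _ : ℕ => Q) (X := fun _ => f) fun _ => hf).indepFun hij
  · intro i
    refine ⟨(hf.comp (hmp i).measurable).aemeasurable, (hf.comp (hmp 0).measurable).aemeasurable, ?_⟩
    have : ∀ i, P.map (fun ω => f (ω i)) = Q.map f := fun i => by
      rw [← (hmp i).map_eq, Measure.map_map hf (hmp i).measurable]; rfl
    rw [this, this]

/-! ### Exponential inter-arrival times -/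

lemma integral_expMeasure {lam : ℝ} (hlam : 0 < lam) (f : ℝ → ℝ) :
    ∫ t, f t ∂(expMeasure lam) = ∫ t in Set.Ioi 0, lam * Real.exp (-(lam * t)) * f t := by
  have hpdf : Measurable (gammaPDF 1 lam) := (measurable_gammaPDFReal 1 lam).ennreal_ofReal
  rw [expMeasure, gammaMeasure, integral_withDensity_eq_integral_toReal_smul hpdf
    (Eventually.of_forall fun _ => ENNReal.ofReal_lt_top), ← integral_Ici_eq_integral_Ioi,
    ← integral_indicator measurableSet_Ici]
  congr 1
  ext t
  change (exponentialPDF lam t).toReal • f t = _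
  rw [exponentialPDF_eq, smul_eq_mul, Set.indicator_apply]
  by_cases ht : 0 ≤ t
  · rw [if_pos ht, if_pos (show t ∈ Set.Ici 0 from ht), ENNReal.toReal_ofReal (by positivity)]
  · rw [if_neg ht, if_neg (show t ∉ Set.Ici 0 from ht)]; simp

lemma integral_id_expMeasure {lam : ℝ} (hlam : 0 < lam) :
    ∫ t, t ∂(expMeasure lam) = 1 / lam := by
  rw [integral_expMeasure hlam]
  have h := Real.integral_rpow_mul_exp_neg_mul_Ioi (a := 2) two_pos hlam
  have h2 : ∀ t : ℝ, lam * Real.exp (-(lam * t)) * t =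
      lam * (t ^ ((2 : ℝ) - 1) * Real.exp (-(lam * t))) := by
    intro t
    rw [show (2 : ℝ) - 1 = 1 by norm_num, Real.rpow_one]; ring
  simp_rw [h2]
  rw [integral_const_mul, h, Real.Gamma_two, Real.rpow_two]
  field_simp

lemma integrable_id_expMeasure {lam : ℝ} (hlam : 0 < lam) :
    Integrable (fun t : ℝ => t) (expMeasure lam) := by
  by_contra h
  have h1 := integral_id_expMeasure hlam
  rw [integral_undef h] at h1
  exact (one_div_pos.2 hlam).ne h1

lemma expMeasure_Iio_zero (lam : ℝ) : expMeasure lam (Set.Iio 0) = 0 := by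
  rw [expMeasure, gammaMeasure, withDensity_apply _ measurableSet_Iio]
  exact lintegral_gammaPDF_of_nonpos le_rfl

/-! ### The law of the supremum -/

section Law

variable {lam : ℝ} {G : Measure ℝ} [IsProbabilityMeasure G]

/-- Under the net profit condition `lam * mean G < 1`, almost surely the interarrival times and
claims are nonnegative, the arrival times tend to infinity and the embedded walk is bounded. -/
lemma ae_path_regular (hlam : 0 < lam) (hG : G (Set.Iio 0) = 0)
    (hint : Integrable (fun x : ℝ => x) G) (hρ : lam * mean G < 1) :
    ∀ᵐ ω ∂(pathLaw lam G), (∀ i, 0 ≤ (ω i).1) ∧ (∀ i, 0 ≤ (ω i).2) ∧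
      Tendsto (arrivalTime ω) atTop atTop ∧ BddAbove (Set.range (walk ω)) := by
  have := isProbabilityMeasure_expMeasure hlam
  set Q := (expMeasure lam).prod G with hQ
  have hmp : ∀ i, MeasurePreserving (fun ω : Path => ω i) (pathLaw lam G) Q := fun i =>
    measurePreserving_eval_infinitePi (fun _ : ℕ => Q) i
  have hfst : Integrable (fun x : ℝ × ℝ => x.1) Q := (integrable_id_expMeasure hlam).comp_fst G
  have hsnd : Integrable (fun x : ℝ × ℝ => x.2) Q := hint.comp_snd _
  have hI1 : ∫ x, x.1 ∂Q = 1 / lam := by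
    rw [hQ, integral_fun_fst (fun t : ℝ => t), integral_id_expMeasure hlam]; simp
  have hI2 : ∫ x, x.2 ∂Q = mean G := by
    rw [hQ, integral_fun_snd (fun t : ℝ => t)]; simp [mean]
  have hA : ∀ᵐ ω ∂(pathLaw lam G), ∀ i, 0 ≤ (ω i).1 := ae_all_iff.2 fun i =>
    (hmp i).quasiMeasurePreserving.ae (Measure.quasiMeasurePreserving_fst.ae
      (ae_nonneg_of_Iio (expMeasure_Iio_zero lam)))
  have hB : ∀ᵐ ω ∂(pathLaw lam G), ∀ i, 0 ≤ (ω i).2 := ae_all_iff.2 fun i =>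
    (hmp i).quasiMeasurePreserving.ae (Measure.quasiMeasurePreserving_snd.ae (ae_nonneg_of_Iio hG))
  have hC := ae_tendsto_average Q measurable_fst hfst
  have hD := ae_tendsto_average Q (measurable_snd.sub measurable_fst) (hsnd.sub hfst)
  filter_upwards [hA, hB, hC, hD] with ω h1 h2 h3 h4
  refine ⟨h1, h2, ?_, ?_⟩
  · rw [hI1] at h3
    have h5 := (h3.pos_mul_atTop (one_div_pos.2 hlam) tendsto_natCast_atTop_atTop)
    have h6 : Tendsto (fun n : ℕ => ∑ i ∈ Finset.range n, (ω i).1) atTop atTop := by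
      refine h5.congr' ?_
      filter_upwards [eventually_gt_atTop 0] with n hn
      rw [div_mul_cancel₀ _ (Nat.cast_ne_zero.2 hn.ne')]
    exact h6.comp (tendsto_add_atTop_nat 1)
  · have hneg : ∫ x, (x.2 - x.1) ∂Q < 0 := by
      rw [integral_sub hsnd hfst, hI1, hI2, sub_neg, lt_div_iff₀ hlam]
      linarith
    have h5 : ∀ᶠ n : ℕ in atTop, walk ω n ≤ 0 := by
      filter_upwards [h4.eventually_lt_const hneg, eventually_gt_atTop 0] with n hn hn0
      have hn1 : (0 : ℝ) < n := Nat.cast_pos.2 hn0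
      have := (div_lt_iff₀ hn1).1 hn
      rw [zero_mul] at this
      exact this.le
    exact isBoundedUnder_of_eventually_le h5 |>.bddAbove_range

/-- The law of the supremum of the claim surplus process. -/
noncomputable def supLaw (lam : ℝ) (G : Measure ℝ) : Measure ℝ := (pathLaw lam G).map supWalk

lemma isProbabilityMeasure_pathLaw (hlam : 0 < lam) : IsProbabilityMeasure (pathLaw lam G) := by
  have := isProbabilityMeasure_expMeasure hlam
  unfold pathLaw
  infer_instance

lemma isProbabilityMeasure_supLaw (hlam : 0 < lam) : IsProbabilityMeasure (supLaw lam G) := by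
  have := isProbabilityMeasure_pathLaw (G := G) hlam
  exact Measure.isProbabilityMeasure_map measurable_supWalk.aemeasurable

lemma ae_maxSurplus_eq (hlam : 0 < lam) (hG : G (Set.Iio 0) = 0)
    (hint : Integrable (fun x : ℝ => x) G) (hρ : lam * mean G < 1) :
    ∀ᵐ ω ∂(pathLaw lam G), maxSurplus ω = ((supWalk ω : ℝ) : EReal) := by
  filter_upwards [ae_path_regular hlam hG hint hρ] with ω hω
  exact maxSurplus_eq_supWalk hω.1 hω.2.1 hω.2.2.1 hω.2.2.2

lemma ruinProb_eq_tail (hlam : 0 < lam) (hG : G (Set.Iio 0) = 0)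
    (hint : Integrable (fun x : ℝ => x) G) (hρ : lam * mean G < 1) (u : ℝ) :
    ruinProb lam G u = tail (supLaw lam G) u := by
  rw [tail, supLaw, map_measureReal_apply measurable_supWalk measurableSet_Ioi, ruinProb]
  refine measureReal_congr ?_
  filter_upwards [ae_maxSurplus_eq hlam hG hint hρ] with ω hω
  refine propext ?_
  change (u : EReal) < maxSurplus ω ↔ u < supWalk ω
  rw [hω, EReal.coe_lt_coe_iff]

lemma supLaw_Iio_zero (hlam : 0 < lam) (hG : G (Set.Iio 0) = 0)
    (hint : Integrable (fun x : ℝ => x) G) (hρ : lam * mean G < 1) :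
    supLaw lam G (Set.Iio 0) = 0 := by
  rw [supLaw, Measure.map_apply measurable_supWalk measurableSet_Iio]
  have : ∀ᵐ ω ∂(pathLaw lam G), 0 ≤ supWalk ω := by
    filter_upwards [ae_path_regular hlam hG hint hρ] with ω hω
    exact supWalk_nonneg hω.2.2.2
  rw [ae_iff] at this
  simpa [Set.preimage, Set.Iio] using this

/-- Conditioning on the first arrival and the first claim. -/
lemma supLaw_Iic_eq (hlam : 0 < lam) (hG : G (Set.Iio 0) = 0)
    (hint : Integrable (fun x : ℝ => x) G) (hρ : lam * mean G < 1) {u : ℝ} (hu : 0 ≤ u) :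
    supLaw lam G (Set.Iic u) =
      ∫⁻ t, (G.conv (supLaw lam G)) (Set.Iic (u + t)) ∂(expMeasure lam) := by
  have := isProbabilityMeasure_expMeasure hlam
  have := isProbabilityMeasure_pathLaw (G := G) hlam
  have := isProbabilityMeasure_supLaw (G := G) hlam
  set Q := (expMeasure lam).prod G with hQ
  set P := pathLaw lam G with hP
  have hcons : (Q.prod P).map consPath = P := map_consPath Q
  set S : Set ((ℝ × ℝ) × Path) := {p | p.1.2 + supWalk p.2 ≤ u + p.1.1} with hS
  have hSm : MeasurableSet S := measurableSet_le (by fun_prop) (by fun_prop)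
  have h1 : supLaw lam G (Set.Iic u) = (Q.prod P) S := by
    rw [supLaw, Measure.map_apply measurable_supWalk measurableSet_Iic, ← hP]
    nth_rewrite 1 [← hcons]
    rw [Measure.map_apply measurable_consPath (measurable_supWalk measurableSet_Iic)]
    refine measure_congr ?_
    have hb : ∀ᵐ p ∂(Q.prod P), BddAbove (Set.range (walk p.2)) :=
      Measure.quasiMeasurePreserving_snd.ae
        ((ae_path_regular hlam hG hint hρ).mono fun _ h => h.2.2.2)
    filter_upwards [hb] with p hp
    refine propext ?_
    change supWalk (consPath (p.1, p.2)) ≤ u ↔ p.1.2 + supWalk p.2 ≤ u + p.1.1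
    rw [supWalk_consPath p.1 hp, max_le_iff]
    constructor
    · rintro ⟨_, h⟩; linarith
    · intro h; exact ⟨hu, by linarith⟩
  rw [h1, Measure.prod_apply hSm, hQ,
    lintegral_prod _ (measurable_measure_prodMk_left hSm).aemeasurable]
  refine lintegral_congr fun t => ?_
  rw [Measure.conv, Measure.map_apply (by fun_prop) measurableSet_Iic,
    Measure.prod_apply ((by fun_prop : Measurable fun x : ℝ × ℝ => x.1 + x.2) measurableSet_Iic)]
  refine lintegral_congr fun x => ?_
  rw [supLaw, Measure.map_apply measurable_supWalk
    (measurable_prodMk_left ((by fun_prop : Measurable fun x : ℝ × ℝ => x.1 + x.2)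
      measurableSet_Iic))]
  rfl

end Law

/-! ### The renewal equation for the supremum -/

/-- If `φ` is an exponential average of `g` over the future, then `φ' = lam * (φ - g)` in the sense
of right derivatives, and the integrated form holds. -/
lemma sub_eq_integral_of_exp_average {φ g : ℝ → ℝ} {lam : ℝ} (hlam : 0 < lam) (hg : Measurable g)
    (hg0 : ∀ x, 0 ≤ g x) (hg1 : ∀ x, g x ≤ 1) (hrc : ∀ x, ContinuousWithinAt g (Set.Ici x) x)
    (h : ∀ u, 0 ≤ u → φ u = ∫ t in Set.Ioi 0, lam * Real.exp (-(lam * t)) * g (u + t))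
    {u : ℝ} (hu : 0 ≤ u) :
    φ u - φ 0 = lam * ((∫ s in 0..u, φ s) - ∫ s in 0..u, g s) := by
  set w : ℝ → ℝ := fun s => lam * Real.exp (-(lam * s)) * g s with hw
  have hwm : Measurable w := by fun_prop
  have hwle : ∀ s, ‖w s‖ ≤ lam * Real.exp (-(lam * s)) := fun s => by
    have h1 : 0 ≤ lam * Real.exp (-(lam * s)) := by positivity
    rw [Real.norm_of_nonneg (mul_nonneg h1 (hg0 s))]
    simpa using mul_le_mul_of_nonneg_left (hg1 s) h1
  have hwI : ∀ a, IntegrableOn w (Set.Ioi a) := fun a => by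
    refine Integrable.mono' (g := fun s => lam * Real.exp (-(lam * s))) ?_
      hwm.aestronglyMeasurable (Eventually.of_forall hwle)
    have := (exp_neg_integrableOn_Ioi a hlam).const_mul lam
    simpa only [neg_mul] using this
  have hwi : ∀ a b, IntervalIntegrable w volume a b := fun a b =>
    intervalIntegrable_iff.2 ((hwI (min a b)).mono_set fun x hx => hx.1)
  have hgi : ∀ a b, IntervalIntegrable g volume a b := fun a b => by
    refine intervalIntegrable_iff.2 (Measure.integrableOn_of_bounded (M := 1)
      measure_Ioc_lt_top.ne hg.aestronglyMeasurable (Eventually.of_forall fun x => ?_))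
    rw [Real.norm_of_nonneg (hg0 x)]; exact hg1 x
  set I := ∫ s in Set.Ioi 0, w s with hI
  set Φ : ℝ → ℝ := fun x => Real.exp (lam * x) * (I - ∫ s in 0..x, w s) with hΦ
  have hφΦ : ∀ x, 0 ≤ x → φ x = Φ x := by
    intro x hx
    have h1 : I - ∫ s in 0..x, w s = ∫ s in Set.Ioi x, w s := by
      have := intervalIntegral.integral_interval_add_Ioi (hwI 0) (hwI x)
      linarith
    have h2 : ∫ s in Set.Ioi x, w s = ∫ t in Set.Ioi 0, w (x + t) := by
      rw [← integral_indicator measurableSet_Ioi, ← integral_indicator measurableSet_Ioi,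
        ← integral_add_left_eq_self _ x]
      congr 1
      ext t
      simp only [Set.indicator_apply, Set.mem_Ioi, lt_add_iff_pos_right]
    rw [hΦ]
    simp only
    rw [h1, h2, h x hx, ← integral_const_mul]
    congr 1
    ext t
    rw [hw]
    simp only
    rw [mul_add, neg_add, Real.exp_add, Real.exp_neg (lam * x)]
    field_simp
  have hcont : Continuous Φ := by
    refine (by fun_prop : Continuous fun x : ℝ => Real.exp (lam * x)).mul
      (continuous_const.sub (intervalIntegral.continuous_primitive hwi 0))
  have hderiv : ∀ x, HasDerivWithinAt Φ (lam * Φ x - lam * g x) (Set.Ioi x) x := by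
    intro x
    have hwc : ContinuousWithinAt w (Set.Ioi x) x :=
      ((by fun_prop : Continuous fun s : ℝ => lam * Real.exp (-(lam * s))).continuousWithinAt.mul
        (hrc x)).mono Set.Ioi_subset_Ici_self
    have h1 : HasDerivWithinAt (fun y => ∫ s in 0..y, w s) (w x) (Set.Ici x) x :=
      intervalIntegral.integral_hasDerivWithinAt_right (hwi 0 x) (t := Set.Ioi x)
        hwm.stronglyMeasurable.stronglyMeasurableAtFilter hwc
    have h2 : HasDerivAt (fun y : ℝ => Real.exp (lam * y)) (Real.exp (lam * x) * (lam * 1)) x :=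
      ((hasDerivAt_id x).const_mul lam).exp
    have h3 := h2.hasDerivWithinAt.mul ((h1.mono Set.Ioi_subset_Ici_self).const_sub I)
    refine h3.congr_deriv ?_
    rw [hΦ, hw]
    simp only
    rw [Real.exp_neg]
    field_simp
    ring
  have hFTC := intervalIntegral.integral_eq_sub_of_hasDeriv_right_of_le hu hcont.continuousOn
    (fun x _ => hderiv x)
    (((hcont.intervalIntegrable 0 u).const_mul lam).sub ((hgi 0 u).const_mul lam))
  have hφint : ∫ s in 0..u, φ s = ∫ s in 0..u, Φ s :=
    intervalIntegral.integral_congr fun s hs => by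
      rw [Set.uIcc_of_le hu] at hs
      exact hφΦ s hs.1
  rw [hφΦ u hu, hφΦ 0 le_rfl, hφint, ← hFTC, intervalIntegral.integral_sub
    ((hcont.intervalIntegrable 0 u).const_mul lam) ((hgi 0 u).const_mul lam),
    intervalIntegral.integral_const_mul, intervalIntegral.integral_const_mul, mul_sub]

lemma measurable_measure_Iic (N : Measure ℝ) [IsFiniteMeasure N] :
    Measurable fun x => N (Set.Iic x) :=
  Monotone.measurable fun _ _ h => measure_mono (Set.Iic_subset_Iic.2 h)

lemma conv_Iic (K N : Measure ℝ) [IsFiniteMeasure K] [IsFiniteMeasure N] (u : ℝ) :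
    (K.conv N) (Set.Iic u) = ∫⁻ x, N (Set.Iic (u - x)) ∂K := by
  have hm : Measurable fun x : ℝ × ℝ => x.1 + x.2 := by fun_prop
  rw [Measure.conv, Measure.map_apply hm measurableSet_Iic, Measure.prod_apply
    (hm measurableSet_Iic)]
  refine lintegral_congr fun x => ?_
  congr 1
  ext y
  simp [le_sub_iff_add_le']

lemma lintegral_measure_Iic_sub {N : Measure ℝ} [IsFiniteMeasure N] (h0 : N (Set.Iio 0) = 0)
    {u : ℝ} (hu : 0 ≤ u) :
    ∫⁻ r in Set.Ici 0, N (Set.Iic (u - r)) =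
      ENNReal.ofReal (∫ s in 0..u, N.real (Set.Iic s)) := by
  have hmono : Monotone fun s => N.real (Set.Iic s) := fun _ _ h =>
    measureReal_mono (Set.Iic_subset_Iic.2 h)
  have h1 : ∫ s in 0..u, N.real (Set.Iic s) = ∫ r in 0..u, N.real (Set.Iic (u - r)) := by
    rw [intervalIntegral.integral_comp_sub_left (fun s => N.real (Set.Iic s)), sub_self, sub_zero]
  have hanti : Antitone fun r => N.real (Set.Iic (u - r)) := fun _ _ h =>
    hmono (sub_le_sub_left h u)
  rw [h1, intervalIntegral.integral_of_le hu, ofReal_integral_eq_lintegral_ofReal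
    (hanti.antitoneOn _ |>.integrableOn_isCompact isCompact_Icc |>.mono_set Set.Ioc_subset_Icc_self)
    (Eventually.of_forall fun _ => measureReal_nonneg), setLIntegral_congr Ioi_ae_eq_Ici.symm,
    ← Set.Ioc_union_Ioi_eq_Ioi hu, lintegral_union measurableSet_Ioi]
  · have h2 : ∫⁻ r in Set.Ioi u, N (Set.Iic (u - r)) = 0 := by
      rw [setLIntegral_congr_fun measurableSet_Ioi (g := fun _ => 0), lintegral_zero]
      intro r hr
      refine measure_mono_null (Set.Iic_subset_Iio.2 ?_) h0
      have : u < r := hr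
      linarith
    rw [h2, add_zero]
    refine lintegral_congr fun r => ?_
    rw [ofReal_measureReal]
  · rw [Set.disjoint_left]
    intro x hx hx'
    exact absurd hx' (not_lt.2 hx.2)

/-- Integration by parts against a law `G` on `[0, ∞)`: Lebesgue measure `ℓ` on `[0, ∞)` is the sum
of the convolution `G * ℓ` and the measure with density the tail of `G`. -/
lemma lintegral_Ici_eq_add {G : Measure ℝ} [IsProbabilityMeasure G] (hG : G (Set.Iio 0) = 0)
    {f : ℝ → ENNReal} (hf : Measurable f) :
    ∫⁻ r in Set.Ici 0, f r = (∫⁻ x, (∫⁻ r in Set.Ici 0, f (r + x)) ∂G) +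
      ∫⁻ r in Set.Ici 0, f r * G (Set.Ioi r) := by
  have hsplit : ∀ x : ℝ, 0 ≤ x → ∫⁻ r in Set.Ici 0, f r =
      (∫⁻ r in Set.Ici 0, f (r + x)) + ∫⁻ r in Set.Ici 0, (Set.Ioi r).indicator (fun _ => f r) x := by
    intro x hx
    have h1 : ∫⁻ r in Set.Ici 0, f (r + x) = ∫⁻ r in Set.Ici x, f r := by
      rw [← lintegral_indicator measurableSet_Ici, ← lintegral_indicator measurableSet_Ici,
        ← lintegral_add_right_eq_self (μ := volume) ((Set.Ici x).indicator f) x]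
      refine lintegral_congr fun r => ?_
      simp only [Set.indicator_apply, Set.mem_Ici, le_add_iff_nonneg_left]
    have h2 : ∫⁻ r in Set.Ici 0, (Set.Ioi r).indicator (fun _ => f r) x =
        ∫⁻ r in Set.Ico 0 x, f r := by
      rw [← lintegral_indicator measurableSet_Ici, ← lintegral_indicator measurableSet_Ico]
      refine lintegral_congr fun r => ?_
      simp only [Set.indicator_apply, Set.mem_Ici, Set.mem_Ioi, Set.mem_Ico]
      by_cases hr : 0 ≤ r <;> simp [hr]
    rw [h1, h2, ← Set.Ico_union_Ici_eq_Ici hx, lintegral_union measurableSet_Ici, add_comm]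
    rw [Set.disjoint_left]
    intro y hy hy'
    exact absurd hy' (not_le.2 hy.2)
  have hmeas1 : Measurable fun x : ℝ => ∫⁻ r in Set.Ici 0, f (r + x) :=
    Measurable.lintegral_prod_right' (f := fun p : ℝ × ℝ => f (p.2 + p.1)) (by fun_prop)
  have hind : Measurable fun p : ℝ × ℝ => (Set.Ioi p.2).indicator (fun _ => f p.2) p.1 := by
    have : (fun p : ℝ × ℝ => (Set.Ioi p.2).indicator (fun _ => f p.2) p.1) =
        {p : ℝ × ℝ | p.2 < p.1}.indicator fun p => f p.2 := by
      ext p; simp [Set.indicator_apply]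
    rw [this]
    exact (by fun_prop : Measurable fun p : ℝ × ℝ => f p.2).indicator
      (measurableSet_lt measurable_snd measurable_fst)
  calc ∫⁻ r in Set.Ici 0, f r = ∫⁻ _x, (∫⁻ r in Set.Ici 0, f r) ∂G := by simp
    _ = ∫⁻ x, ((∫⁻ r in Set.Ici 0, f (r + x)) +
          ∫⁻ r in Set.Ici 0, (Set.Ioi r).indicator (fun _ => f r) x) ∂G := by
        refine lintegral_congr_ae ?_
        filter_upwards [ae_nonneg_of_Iio hG] with x hx
        exact hsplit x hx
    _ = _ := by
        rw [lintegral_add_left hmeas1, lintegral_lintegral_swap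
          (f := fun x r => (Set.Ioi r).indicator (fun _ => f r) x) hind.aemeasurable]
        congr 1
        refine lintegral_congr fun r => ?_
        rw [lintegral_indicator measurableSet_Ioi, lintegral_const,
          Measure.restrict_apply_univ]

/-- The measure with density `lam * tail G` on `[0, ∞)`: the defective law of the first ascending
ladder height of the surplus process, and the kernel of its renewal equation. -/
noncomputable def ladderMeasure (lam : ℝ) (G : Measure ℝ) : Measure ℝ :=
  (volume.restrict (Set.Ici 0)).withDensity fun t => ENNReal.ofReal (lam * tail G t)

lemma ladderMeasure_Iio_zero (lam : ℝ) (G : Measure ℝ) : ladderMeasure lam G (Set.Iio 0) = 0 := by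
  rw [ladderMeasure, withDensity_apply _ measurableSet_Iio,
    Measure.restrict_restrict measurableSet_Iio]
  have : Set.Iio (0 : ℝ) ∩ Set.Ici 0 = ∅ := by
    ext x; simp
  rw [this, Measure.restrict_empty, lintegral_zero_measure]

lemma mean_nonneg {G : Measure ℝ} (hG : G (Set.Iio 0) = 0) : 0 ≤ mean G :=
  integral_nonneg_of_ae (ae_nonneg_of_Iio hG)

section Ladder

variable {lam : ℝ} {G : Measure ℝ} [IsProbabilityMeasure G]

lemma ladderMeasure_univ (hlam : 0 ≤ lam) (hG : G (Set.Iio 0) = 0)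
    (hint : Integrable (fun x : ℝ => x) G) :
    ladderMeasure lam G Set.univ = ENNReal.ofReal (lam * mean G) := by
  have h1 := lintegral_eq_lintegral_meas_lt G (f := fun x => x) (ae_nonneg_of_Iio hG)
    measurable_id.aemeasurable
  have h2 := ofReal_integral_eq_lintegral_ofReal hint (ae_nonneg_of_Iio hG)
  rw [ladderMeasure, withDensity_apply _ MeasurableSet.univ, Measure.restrict_univ,
    setLIntegral_congr Ioi_ae_eq_Ici.symm, ENNReal.ofReal_mul hlam, mean, h2, h1,
    ← lintegral_const_mul' _ _ ENNReal.ofReal_ne_top]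
  refine lintegral_congr fun t => ?_
  rw [ENNReal.ofReal_mul hlam, tail, ofReal_measureReal]
  rfl

lemma isFiniteMeasure_ladderMeasure (hlam : 0 ≤ lam) (hG : G (Set.Iio 0) = 0)
    (hint : Integrable (fun x : ℝ => x) G) : IsFiniteMeasure (ladderMeasure lam G) :=
  ⟨by rw [ladderMeasure_univ hlam hG hint]; exact ENNReal.ofReal_lt_top⟩

lemma ladderMeasure_real_univ (hlam : 0 ≤ lam) (hG : G (Set.Iio 0) = 0)
    (hint : Integrable (fun x : ℝ => x) G) :
    (ladderMeasure lam G).real Set.univ = lam * mean G := by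
  rw [measureReal_def, ladderMeasure_univ hlam hG hint,
    ENNReal.toReal_ofReal (mul_nonneg hlam (mean_nonneg hG))]

/-- The renewal equation in terms of distribution functions. -/
lemma supLaw_real_Iic_sub (hlam : 0 < lam) (hG : G (Set.Iio 0) = 0)
    (hint : Integrable (fun x : ℝ => x) G) (hρ : lam * mean G < 1) {u : ℝ} (hu : 0 ≤ u) :
    (supLaw lam G).real (Set.Iic u) - (supLaw lam G).real (Set.Iic 0) =
      ((ladderMeasure lam G).conv (supLaw lam G)).real (Set.Iic u) := by
  have := isProbabilityMeasure_supLaw (G := G) hlam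
  have := isFiniteMeasure_ladderMeasure hlam.le hG hint
  set ν := supLaw lam G with hν
  set g : ℝ → ℝ := fun v => (G.conv ν).real (Set.Iic v) with hg
  have hν0 : ν (Set.Iio 0) = 0 := supLaw_Iio_zero hlam hG hint hρ
  have hgcdf : g = cdf (G.conv ν) := by
    ext v; rw [cdf_eq_real]
  have hgm : Measurable g := by rw [hgcdf]; exact (monotone_cdf _).measurable
  have havg : ∀ u, 0 ≤ u → ν.real (Set.Iic u) =
      ∫ t in Set.Ioi 0, lam * Real.exp (-(lam * t)) * g (u + t) := by
    intro u hu
    rw [← integral_expMeasure hlam (fun t => g (u + t)), measureReal_def,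
      supLaw_Iic_eq hlam hG hint hρ hu]
    exact (integral_toReal ((measurable_measure_Iic _).comp (measurable_const_add u)).aemeasurable
      (Eventually.of_forall fun t => measure_lt_top _ _)).symm
  have hkey := sub_eq_integral_of_exp_average (φ := fun u => ν.real (Set.Iic u)) hlam hgm
    (fun _ => measureReal_nonneg) (fun _ => measureReal_le_one)
    (fun x => by rw [hgcdf]; exact (cdf _).right_continuous x) havg hu
  have hpos : ∀ N : Measure ℝ, 0 ≤ ∫ s in 0..u, N.real (Set.Iic s) := fun N =>
    intervalIntegral.integral_nonneg hu fun _ _ => measureReal_nonneg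
  have hf : Measurable fun r : ℝ => ν (Set.Iic (u - r)) :=
    (measurable_measure_Iic ν).comp (measurable_const.sub measurable_id)
  have hparts := lintegral_Ici_eq_add hG hf
  have hsecond : (∫⁻ x, (∫⁻ r in Set.Ici 0, ν (Set.Iic (u - (r + x)))) ∂G) =
      ∫⁻ r in Set.Ici 0, (G.conv ν) (Set.Iic (u - r)) := by
    have hswap := lintegral_lintegral_swap (μ := G) (ν := volume.restrict (Set.Ici 0))
      (f := fun x r => ν (Set.Iic (u - (r + x)))) ((measurable_measure_Iic ν).comp
        (by fun_prop : Measurable fun p : ℝ × ℝ => u - (p.2 + p.1))).aemeasurable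
    rw [hswap]
    congr 1
    ext r
    rw [conv_Iic]
    refine lintegral_congr fun x => ?_
    rw [sub_sub]
  have hthird : ((ladderMeasure lam G).conv ν) (Set.Iic u) =
      ENNReal.ofReal lam * ∫⁻ r in Set.Ici 0, ν (Set.Iic (u - r)) * G (Set.Ioi r) := by
    rw [conv_Iic, ladderMeasure, lintegral_withDensity_eq_lintegral_mul _
      ((measurable_tail G).const_mul lam).ennreal_ofReal hf,
      ← lintegral_const_mul' _ _ ENNReal.ofReal_ne_top]
    refine lintegral_congr fun r => ?_
    rw [Pi.mul_apply, ENNReal.ofReal_mul hlam.le, tail, ofReal_measureReal, mul_assoc,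
      mul_comm (G _)]
  rw [hsecond, lintegral_measure_Iic_sub hν0 hu,
    lintegral_measure_Iic_sub (conv_Iio_zero hG hν0) hu] at hparts
  have hfin : ∫⁻ r in Set.Ici 0, ν (Set.Iic (u - r)) * G (Set.Ioi r) ≠ ⊤ := by
    intro h
    rw [h, add_top] at hparts
    exact ENNReal.ofReal_ne_top hparts
  have hreal := congrArg ENNReal.toReal hparts
  rw [ENNReal.toReal_add ENNReal.ofReal_ne_top hfin, ENNReal.toReal_ofReal (hpos _),
    ENNReal.toReal_ofReal (hpos _)] at hreal
  rw [hkey, measureReal_def, hthird, ENNReal.toReal_mul, ENNReal.toReal_ofReal hlam.le]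
  congr 1
  linarith

/-- The renewal equation for the ruin probability. The mass at the origin is identified as
`1 - lam * mean G` by letting `u → ∞` in the equation for distribution functions. -/
theorem tail_supLaw_eq (hlam : 0 < lam) (hG : G (Set.Iio 0) = 0)
    (hint : Integrable (fun x : ℝ => x) G) (hρ : lam * mean G < 1) {u : ℝ} (hu : 0 ≤ u) :
    tail (supLaw lam G) u = tail ((ladderMeasure lam G).conv (supLaw lam G)) u := by
  have := isProbabilityMeasure_supLaw (G := G) hlam
  have := isFiniteMeasure_ladderMeasure hlam.le hG hint
  set ν := supLaw lam G
  set κ := (ladderMeasure lam G).conv ν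
  have h1 : Tendsto (fun u => ν.real (Set.Iic u) - ν.real (Set.Iic 0)) atTop
      (𝓝 (ν.real Set.univ - ν.real (Set.Iic 0))) := (tendsto_real_Iic_atTop ν).sub_const _
  have h2 := tendsto_nhds_unique (h1.congr' ?_) (tendsto_real_Iic_atTop κ)
  · have h3 := supLaw_real_Iic_sub hlam hG hint hρ hu
    have h4 := real_Iic_add_tail ν u
    have h5 := real_Iic_add_tail κ u
    change _ - _ = κ.real (Set.Iic u) at h3
    linarith
  · filter_upwards [eventually_ge_atTop 0] with v hv
    exact supLaw_real_Iic_sub hlam hG hint hρ hv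

end Ladder

/-! ### Mixtures of claim laws -/

section Mixture

variable {ε : ℝ} {μ ν : Measure ℝ}

lemma isProbabilityMeasure_mixture [IsProbabilityMeasure μ] [IsProbabilityMeasure ν]
    (h0 : 0 ≤ ε) (h1 : ε ≤ 1) : IsProbabilityMeasure (mixture ε μ ν) := by
  constructor
  simp only [mixture, Measure.coe_add, Measure.coe_smul, Pi.add_apply, Pi.smul_apply,
    measure_univ, smul_eq_mul, mul_one]
  rw [← ENNReal.ofReal_add (by linarith) h0, sub_add_cancel, ENNReal.ofReal_one]

lemma mixture_Iio_zero (hμ : μ (Set.Iio 0) = 0) (hν : ν (Set.Iio 0) = 0) :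
    mixture ε μ ν (Set.Iio 0) = 0 := by
  simp [mixture, hμ, hν]

lemma integrable_mixture (hμ : Integrable (fun x : ℝ => x) μ)
    (hν : Integrable (fun x : ℝ => x) ν) : Integrable (fun x : ℝ => x) (mixture ε μ ν) :=
  (hμ.smul_measure ENNReal.ofReal_ne_top).add_measure (hν.smul_measure ENNReal.ofReal_ne_top)

lemma mean_mixture (h0 : 0 ≤ ε) (h1 : ε ≤ 1) (hμ : Integrable (fun x : ℝ => x) μ)
    (hν : Integrable (fun x : ℝ => x) ν) :
    mean (mixture ε μ ν) = (1 - ε) * mean μ + ε * mean ν := by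
  rw [mean, mixture, integral_add_measure (hμ.smul_measure ENNReal.ofReal_ne_top)
    (hν.smul_measure ENNReal.ofReal_ne_top), integral_smul_measure, integral_smul_measure,
    ENNReal.toReal_ofReal (by linarith), ENNReal.toReal_ofReal h0]
  rfl

lemma tail_mixture [IsFiniteMeasure μ] [IsFiniteMeasure ν] (h0 : 0 ≤ ε) (h1 : ε ≤ 1) (u : ℝ) :
    tail (mixture ε μ ν) u = (1 - ε) * tail μ u + ε * tail ν u := by
  have : IsFiniteMeasure (ENNReal.ofReal (1 - ε) • μ) := μ.smul_finite ENNReal.ofReal_ne_top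
  have : IsFiniteMeasure (ENNReal.ofReal ε • ν) := ν.smul_finite ENNReal.ofReal_ne_top
  rw [tail, mixture, measureReal_add_apply, measureReal_ennreal_smul_apply,
    measureReal_ennreal_smul_apply, ENNReal.toReal_ofReal (by linarith), ENNReal.toReal_ofReal h0]
  rfl

lemma ladderMeasure_mixture [IsFiniteMeasure μ] [IsFiniteMeasure ν] (h0 : 0 ≤ ε) (h1 : ε ≤ 1)
    {lam : ℝ} (hlam : 0 ≤ lam) :
    ladderMeasure lam (mixture ε μ ν) =
      mixture ε (ladderMeasure lam μ) (ladderMeasure lam ν) := by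
  have hmμ : Measurable fun t => ENNReal.ofReal (lam * tail μ t) :=
    ((measurable_tail μ).const_mul lam).ennreal_ofReal
  have hmν : Measurable fun t => ENNReal.ofReal (lam * tail ν t) :=
    ((measurable_tail ν).const_mul lam).ennreal_ofReal
  have hsplit : mixture ε (ladderMeasure lam μ) (ladderMeasure lam ν) =
      ENNReal.ofReal (1 - ε) • ladderMeasure lam μ + ENNReal.ofReal ε • ladderMeasure lam ν := rfl
  rw [hsplit, ladderMeasure, ladderMeasure, ladderMeasure, ← withDensity_smul _ hmμ,
    ← withDensity_smul _ hmν, ← withDensity_add_left (hmμ.const_smul _)]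
  congr 1
  ext t
  simp only [Pi.add_apply, Pi.smul_apply, smul_eq_mul]
  have hμ := tail_nonneg μ t
  have hν := tail_nonneg ν t
  have h1' : 0 ≤ 1 - ε := by linarith
  rw [← ENNReal.ofReal_mul h1', ← ENNReal.ofReal_mul h0,
    ← ENNReal.ofReal_add (by positivity) (by positivity), tail_mixture h0 h1]
  congr 1
  ring

lemma ladderMeasure_dirac_zero (lam : ℝ) : ladderMeasure lam (Measure.dirac 0) = 0 := by
  rw [ladderMeasure, withDensity_congr_ae (g := 0)]
  · exact withDensity_zero
  · filter_upwards [ae_restrict_mem measurableSet_Ici] with t ht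
    have : tail (Measure.dirac 0) t = 0 := by
      have : (0 : ℝ) ∉ Set.Ioi t := by
        have h0 : 0 ≤ t := ht
        simpa using h0
      rw [tail, measureReal_def, Measure.dirac_apply' _ measurableSet_Ioi,
        Set.indicator_of_notMem this]
      rfl
    simp [this]

lemma tail_ladderMeasure_eq [IsFiniteMeasure μ] (hμ : 0 < mean μ) {lam : ℝ} (hlam : 0 ≤ lam)
    (u : ℝ) : tail (ladderMeasure lam μ) u = lam * mean μ * tail (stationaryExcess μ) u := by
  have : ladderMeasure lam μ = ENNReal.ofReal (lam * mean μ) • stationaryExcess μ := by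
    rw [ladderMeasure, stationaryExcess, ← withDensity_smul _
      ((measurable_tail μ).div_const _).ennreal_ofReal]
    congr 1
    ext t
    rw [Pi.smul_apply, smul_eq_mul, ← ENNReal.ofReal_mul (by positivity)]
    congr 1
    field_simp
  rw [this, tail, measureReal_ennreal_smul_apply, ENNReal.toReal_ofReal (by positivity)]
  rfl

end Mixture

/-- For a phase-type claim law the kernel of the renewal equation is negligible compared with any
subexponential tail. -/
lemma IsPhaseType.tendsto_tail_ladderMeasure {μ F : Measure ℝ} (hμ : IsPhaseType μ)
    (hF : IsSubexponential F) {lam : ℝ} (hlam : 0 ≤ lam) :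
    Tendsto (fun u => tail (ladderMeasure lam μ) u / tail F u) atTop (𝓝 0) := by
  obtain ⟨A, s, hs, hA⟩ := hμ.exists_tail_le_exp
  have hA0 : 0 ≤ A := by simpa using (tail_nonneg μ 0).trans (hA 0 le_rfl)
  have hbound : ∀ u, 0 ≤ u →
      tail (ladderMeasure lam μ) u ≤ lam * A / s * Real.exp (-(s * u)) := by
    intro u hu
    have hint : IntegrableOn (fun t => lam * (A * Real.exp (-s * t))) (Set.Ioi u) :=
      ((exp_neg_integrableOn_Ioi u hs).const_mul A).const_mul lam
    have hval : ∫ t in Set.Ioi u, lam * (A * Real.exp (-s * t)) =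
        lam * A / s * Real.exp (-(s * u)) := by
      rw [integral_const_mul, integral_const_mul, integral_exp_mul_Ioi (neg_lt_zero.2 hs),
        neg_mul]
      field_simp
    rw [← hval, tail, measureReal_def, ladderMeasure, withDensity_apply _ measurableSet_Ioi,
      Measure.restrict_restrict measurableSet_Ioi,
      Set.inter_eq_left.2 (Set.Ioi_subset_Ici hu)]
    refine ENNReal.toReal_le_of_le_ofReal (integral_nonneg fun t => by positivity) ?_
    rw [ofReal_integral_eq_lintegral_ofReal hint (Eventually.of_forall fun t => by positivity)]
    refine setLIntegral_mono' measurableSet_Ioi fun t ht => ENNReal.ofReal_le_ofReal ?_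
    have := hA t (hu.trans (le_of_lt ht))
    rw [← neg_mul] at this
    exact mul_le_mul_of_nonneg_left this hlam
  have hlim := (hF.tendsto_exp_div hs).const_mul (lam * A / s)
  rw [mul_zero] at hlim
  refine squeeze_zero' (Eventually.of_forall fun u => div_nonneg (tail_nonneg _ _)
    (tail_nonneg _ _)) ?_ hlim
  filter_upwards [eventually_ge_atTop 0] with u hu
  rw [← mul_div_assoc]
  exact div_le_div_of_nonneg_right (hbound u hu) (tail_nonneg _ _)

section RuinAsymptotics

variable {lam : ℝ} {G : Measure ℝ} [IsProbabilityMeasure G]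

/-- The tail of the supremum of the surplus process, when the tail of the renewal kernel is
asymptotically `k` times a subexponential tail. -/
lemma IsSubexponential.tendsto_tail_supLaw {F : Measure ℝ} (hF : IsSubexponential F)
    (hlam : 0 < lam) (hG : G (Set.Iio 0) = 0) (hint : Integrable (fun x : ℝ => x) G)
    (hρ : lam * mean G < 1) {k : ℝ}
    (hk : Tendsto (fun u => tail (ladderMeasure lam G) u / tail F u) atTop (𝓝 k)) :
    Tendsto (fun u => tail (supLaw lam G) u / tail F u) atTop (𝓝 (k / (1 - lam * mean G))) := by
  have := isProbabilityMeasure_supLaw (G := G) hlam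
  have := isFiniteMeasure_ladderMeasure hlam.le hG hint
  have huniv := ladderMeasure_real_univ hlam.le hG hint
  rw [← huniv]
  exact hF.tendsto_tail_of_renewal (supLaw_Iio_zero hlam hG hint hρ)
    (ladderMeasure_Iio_zero lam G) (by rwa [huniv]) hk
    fun u hu => tail_supLaw_eq hlam hG hint hρ hu

/-- Ruin has positive probability for every initial capital: ladder heights exceed some `a > 0`
with positive probability, and several of them in a row exceed any level. -/
lemma tail_supLaw_pos (hlam : 0 < lam) (hG : G (Set.Iio 0) = 0)
    (hint : Integrable (fun x : ℝ => x) G) (hmean : 0 < mean G) (hρ : lam * mean G < 1) (u : ℝ) :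
    0 < tail (supLaw lam G) u := by
  have := isProbabilityMeasure_supLaw (G := G) hlam
  have := isFiniteMeasure_ladderMeasure hlam.le hG hint
  set ν := supLaw lam G
  set K := ladderMeasure lam G
  obtain ⟨n, hn⟩ : ∃ n : ℕ, K (Set.Ioi (1 / ((n : ℝ) + 1))) ≠ 0 := by
    by_contra! hall
    have h1 : K (⋃ n : ℕ, Set.Ioi (1 / ((n : ℝ) + 1))) = 0 := measure_iUnion_null hall
    have h2 : Set.Ioi (0 : ℝ) ⊆ ⋃ n : ℕ, Set.Ioi (1 / ((n : ℝ) + 1)) := fun x hx =>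
      Set.mem_iUnion.2 ((exists_nat_one_div_lt (show (0 : ℝ) < x from hx)).imp fun _ h => h)
    have h3 : K {0} = 0 :=
      ((withDensity_absolutelyContinuous _ _).trans Measure.absolutelyContinuous_restrict)
        Real.volume_singleton
    have h4 : K Set.univ = 0 := by
      refine measure_mono_null (t := Set.Iio 0 ∪ {0} ∪ Set.Ioi 0) ?_
        (measure_union_null (measure_union_null (ladderMeasure_Iio_zero lam G) h3)
          (measure_mono_null h2 h1))
      intro x _
      rcases lt_trichotomy x 0 with h | h | h
      · exact Or.inl (Or.inl h)
      · exact Or.inl (Or.inr h)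
      · exact Or.inr h
    have h5 := ladderMeasure_real_univ hlam.le hG hint
    have h6 : K.real Set.univ = 0 := by rw [measureReal_def, h4]; rfl
    have : 0 < lam * mean G := by positivity
    change K.real Set.univ = _ at h5
    linarith
  set a : ℝ := 1 / ((n : ℝ) + 1)
  have ha : 0 < a := by positivity
  have hKa : 0 < tail K a := ENNReal.toReal_pos hn (measure_ne_top _ _)
  have hstep : ∀ v, 0 ≤ v + a → tail K a * tail ν v ≤ tail ν (v + a) := by
    intro v hv
    rw [tail_supLaw_eq hlam hG hint hρ hv, tail_conv_eq, tail, tail, ← measureReal_prod_prod]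
    refine measureReal_mono ?_
    rintro p ⟨h1, h2⟩
    have h1' : a < p.1 := h1
    have h2' : v < p.2 := h2
    change v + a < p.1 + p.2
    linarith
  have hind : ∀ m : ℕ, 0 < tail ν (m * a - a) := by
    intro m
    induction m with
    | zero =>
      rw [tail_eq_of_neg (supLaw_Iio_zero hlam hG hint hρ) (by simpa using ha), probReal_univ]
      exact one_pos
    | succ m ih =>
      have h1 : ((m + 1 : ℕ) : ℝ) * a - a = (m * a - a) + a := by push_cast; ring
      rw [h1]
      exact (mul_pos hKa ih).trans_le (hstep _ (by rw [sub_add_cancel]; positivity))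
  obtain ⟨m, hm⟩ := exists_nat_gt ((u + a) / a)
  refine (hind m).trans_le (tail_antitone ν ?_)
  have := (div_lt_iff₀ ha).1 hm
  linarith

/-- The extended-real definition of the correction term as the tail of a convolution. -/
lemma measureReal_sum_maxSurplus_eq_tail (hlam : 0 < lam) (hG : G (Set.Iio 0) = 0)
    (hint : Integrable (fun x : ℝ => x) G) (hρ : lam * mean G < 1) (F : Measure ℝ)
    [IsProbabilityMeasure F] (u : ℝ) :
    ((pathLaw lam G).prod ((pathLaw lam G).prod F)).real
      {p : Path × Path × ℝ |
        (u : EReal) < maxSurplus p.1 + maxSurplus p.2.1 + ((p.2.2 : ℝ) : EReal)} =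
      tail ((supLaw lam G).conv ((supLaw lam G).conv F)) u := by
  have := isProbabilityMeasure_pathLaw (G := G) hlam
  have := isProbabilityMeasure_supLaw (G := G) hlam
  set P := pathLaw lam G with hP
  have hm : Measurable fun q : Path × ℝ => supWalk q.1 + q.2 := by fun_prop
  have hconv : (supLaw lam G).conv F = (P.prod F).map fun q => supWalk q.1 + q.2 := by
    have h1 := Measure.map_prod_map P F measurable_supWalk measurable_id
    rw [Measure.map_id] at h1
    rw [Measure.conv, supLaw, ← hP, h1, Measure.map_map (by fun_prop) (by fun_prop)]
    rfl
  have hprod : (supLaw lam G).prod ((supLaw lam G).conv F) =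
      (P.prod (P.prod F)).map (Prod.map supWalk fun q => supWalk q.1 + q.2) := by
    rw [hconv, supLaw, ← hP, Measure.map_prod_map _ _ measurable_supWalk hm]
  have hs : MeasurableSet {p : ℝ × ℝ | u < p.1 + p.2} :=
    measurableSet_lt measurable_const (by fun_prop)
  rw [tail_conv_eq, hprod, map_measureReal_apply (by fun_prop) hs]
  refine measureReal_congr ?_
  have hae := ae_maxSurplus_eq hlam hG hint hρ
  filter_upwards [Measure.quasiMeasurePreserving_fst.ae (μa := P.prod (P.prod F)) hae,
    Measure.quasiMeasurePreserving_snd.ae (μa := P.prod (P.prod F))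
      (Measure.quasiMeasurePreserving_fst.ae (μa := P.prod F) hae)] with p h1 h2
  refine propext ?_
  change (u : EReal) < maxSurplus p.1 + maxSurplus p.2.1 + ((p.2.2 : ℝ) : EReal) ↔
    u < supWalk p.1 + (supWalk p.2.1 + p.2.2)
  rw [h1, h2, ← EReal.coe_add, ← EReal.coe_add, EReal.coe_lt_coe_iff, add_assoc]

end RuinAsymptotics

end RiskModel

theorem lemmal
    (lam ε δ θ : ℝ) (μB μC : Measure ℝ) [IsProbabilityMeasure μC]
    (hlam : 0 < lam) (hε₀ : 0 ≤ ε) (hε₁ : ε ≤ 1)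
    (hB : RiskModel.IsPhaseType μB)
    (hB_int : Integrable (fun x : ℝ => x) μB) (hB_mean : 0 < RiskModel.mean μB)
    (hC : μC (Set.Iio 0) = 0)
    (hC_int : Integrable (fun x : ℝ => x) μC) (hC_mean : 0 < RiskModel.mean μC)
    (hδ : δ = lam * RiskModel.mean μB) (hθ : θ = lam * RiskModel.mean μC)
    (hstable : (1 - ε) * δ + ε * θ < 1)
    (hCe : RiskModel.IsSubexponential (RiskModel.stationaryExcess μC)) :
    Tendsto (fun u : ℝ => RiskModel.relativeError lam ε μB μC u) atTop
      (𝓝 (ε * θ / (1 - δ + ε * δ))) := by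
  have := hB.isProbabilityMeasure
  have := hCe.isProbabilityMeasure
  have hpos := hCe.tail_pos
  set F := RiskModel.stationaryExcess μC with hF
  have hθ0 : 0 < θ := by rw [hθ]; positivity
  have hδ0 : 0 < δ := by rw [hδ]; positivity
  -- The base model, in which claims are discarded with probability `ε`.
  set D := RiskModel.discardLaw ε μB with hD
  have hD0 : D (Set.Iio 0) = 0 :=
    RiskModel.mixture_Iio_zero hB.nonneg (by simp)
  have hDint : Integrable (fun x : ℝ => x) D :=
    RiskModel.integrable_mixture hB_int (integrable_dirac (by simp))
  have : IsProbabilityMeasure D := RiskModel.isProbabilityMeasure_mixture hε₀ hε₁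
  have hDmean : lam * RiskModel.mean D = (1 - ε) * δ := by
    rw [hD, RiskModel.discardLaw, RiskModel.mean_mixture hε₀ hε₁ hB_int
      (integrable_dirac (by simp)), hδ]
    simp only [RiskModel.mean, integral_dirac]
    ring
  have hDρ : lam * RiskModel.mean D < 1 := by
    rw [hDmean]; nlinarith
  -- The exact model.
  set X := RiskModel.mixture ε μB μC with hX
  have hX0 : X (Set.Iio 0) = 0 := RiskModel.mixture_Iio_zero hB.nonneg hC
  have hXint : Integrable (fun x : ℝ => x) X := RiskModel.integrable_mixture hB_int hC_int
  have : IsProbabilityMeasure X := RiskModel.isProbabilityMeasure_mixture hε₀ hε₁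
  have hXmean : lam * RiskModel.mean X = (1 - ε) * δ + ε * θ := by
    rw [hX, RiskModel.mean_mixture hε₀ hε₁ hB_int hC_int, hδ, hθ]
    ring
  have hXρ : lam * RiskModel.mean X < 1 := by rwa [hXmean]
  have hψ : ∀ u, RiskModel.exactRuin lam ε μB μC u = RiskModel.tail (RiskModel.supLaw lam X) u :=
    RiskModel.ruinProb_eq_tail hlam hX0 hXint hXρ
  have hψd : ∀ u, RiskModel.discardRuin lam ε μB u = RiskModel.tail (RiskModel.supLaw lam D) u :=
    RiskModel.ruinProb_eq_tail hlam hD0 hDint hDρ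
  have hcorr : ∀ u, RiskModel.correctionTail lam ε μB μC u = RiskModel.tail
      ((RiskModel.supLaw lam D).conv ((RiskModel.supLaw lam D).conv F)) u :=
    RiskModel.measureReal_sum_maxSurplus_eq_tail hlam hD0 hDint hDρ F
  have hden : 0 < 1 - δ + ε * δ := by
    rw [hDmean] at hDρ; linarith
  set c := ε * θ / (1 - δ + ε * δ) with hc
  have herr : ∀ u, RiskModel.relativeError lam ε μB μC u =
      1 - (RiskModel.tail (RiskModel.supLaw lam D) u + c * (RiskModel.tail
        ((RiskModel.supLaw lam D).conv ((RiskModel.supLaw lam D).conv F)) u -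
          RiskModel.tail (RiskModel.supLaw lam D) u)) /
        RiskModel.tail (RiskModel.supLaw lam X) u := by
    intro u
    rw [RiskModel.relativeError, RiskModel.correctedDiscard, hψ, hψd, hcorr, ← hδ, ← hθ]
  simp_rw [herr]
  rcases hε₀.eq_or_lt with hε | hε
  · -- Without claims of law `μC` the approximation is exact, and `P(M > u)` never vanishes.
    have hXD : X = D := by
      rw [hX, hD, RiskModel.discardLaw, ← hε]
      simp [RiskModel.mixture]
    have hc0 : c = 0 := by rw [hc, ← hε]; simp
    have hmean : 0 < RiskModel.mean D := by
      refine pos_of_mul_pos_right ?_ hlam.le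
      rw [hDmean, ← hε]; simpa using hδ0
    rw [hc0]
    refine tendsto_const_nhds.congr fun u => ?_
    have := RiskModel.tail_supLaw_pos hlam hD0 hDint hmean hDρ u
    rw [hXD, zero_mul, add_zero, div_self this.ne', sub_self]
  have : IsFiniteMeasure (RiskModel.ladderMeasure lam μB) :=
    RiskModel.isFiniteMeasure_ladderMeasure hlam.le hB.nonneg hB_int
  have : IsFiniteMeasure (RiskModel.ladderMeasure lam μC) :=
    RiskModel.isFiniteMeasure_ladderMeasure hlam.le hC hC_int
  have hself : Tendsto (fun u => RiskModel.tail F u / RiskModel.tail F u) atTop (𝓝 1) :=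
    tendsto_const_nhds.congr fun u => by rw [div_self (hpos u).ne']
  have hladB := (hB.tendsto_tail_ladderMeasure hCe hlam.le).const_mul (1 - ε)
  have hladD : Tendsto (fun u => RiskModel.tail (RiskModel.ladderMeasure lam D) u /
      RiskModel.tail F u) atTop (𝓝 0) := by
    rw [mul_zero] at hladB
    refine hladB.congr fun u => ?_
    rw [hD, RiskModel.discardLaw, RiskModel.ladderMeasure_mixture hε₀ hε₁ hlam.le,
      RiskModel.ladderMeasure_dirac_zero, RiskModel.tail_mixture hε₀ hε₁]
    simp [RiskModel.tail, mul_div_assoc]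
  have hladX : Tendsto (fun u => RiskModel.tail (RiskModel.ladderMeasure lam X) u /
      RiskModel.tail F u) atTop (𝓝 (ε * θ)) := by
    have h1 := hladB.add_const (ε * θ)
    rw [mul_zero, zero_add] at h1
    refine h1.congr fun u => ?_
    rw [hX, RiskModel.ladderMeasure_mixture hε₀ hε₁ hlam.le, RiskModel.tail_mixture hε₀ hε₁,
      RiskModel.tail_ladderMeasure_eq hC_mean hlam.le, ← hθ, ← hF]
    have := (hpos u).ne'
    field_simp
  have := RiskModel.isProbabilityMeasure_supLaw (G := D) hlam
  have hsupD0 := RiskModel.supLaw_Iio_zero hlam hD0 hDint hDρ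
  have hlimX := hCe.tendsto_tail_supLaw hlam hX0 hXint hXρ hladX
  have hlimD := hCe.tendsto_tail_supLaw hlam hD0 hDint hDρ hladD
  rw [zero_div] at hlimD
  have hlimF := hCe.tendsto_tail_conv hsupD0 hCe.nonneg hlimD hself
  have hlimC := hCe.tendsto_tail_conv hsupD0 (RiskModel.conv_Iio_zero hsupD0 hCe.nonneg)
    hlimD hlimF
  simp only [probReal_univ, mul_one, zero_add] at hlimC
  have hρ0 : 0 < 1 - ((1 - ε) * δ + ε * θ) := by linarith
  rw [hXmean] at hlimX
  have hεθ : 0 < ε * θ := mul_pos hε hθ0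
  have hlim := ((hlimD.add ((hlimC.sub hlimD).const_mul c)).div hlimX
    (div_pos hεθ hρ0).ne').const_sub 1
  have hval : 1 - (0 + c * (1 - 0)) / (ε * θ / (1 - ((1 - ε) * δ + ε * θ))) = c := by
    rw [hc]
    field_simp
    ring
  rw [hval] at hlim
  refine hlim.congr fun u => ?_
  congr 1
  simp only [Pi.div_apply]
  rw [← sub_div, ← mul_div_assoc, ← add_div, div_div_div_cancel_right₀ (hpos u).ne']
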